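/- For positive integers $m,n$, let $\Delta^m_n$ be the simple graph with vertices $e_i$ ($1\le i\le n$) and $f^k_i$ ($1\le i\le n-1$, $1\le k\le m$), whose edges are exactly $f^k_i\sim f^k_{i+1}$ ($1\le i\le n-2$, $1\le k\le m$) and $e_i\sim f^k_i\sim e_{i+1}$ ($1\le i\le n-1$, $1\le k\le m$). For a graph $G$, let $I(G)$ be its independence complex, that is, the simplicial complex whose simplices are the independent sets of $G$; topological statements about $I(G)$ refer to its geometric realization. Let $S^d$ be the $d$-dimensional unit sphere with base point $(1,0,\dots,0)$, let $\vee$ denote the wedge sum (the disjoint union with the base points identified) and $\simeq$ homotopy equivalence. Then for every integer $m\ge 2$: 1. $I(\Delta^m_1)$ is a single point; 2. $I(\Delta^m_2)\simeq S^0$; 3. $I(\Delta^m_3)\simeq S^1\vee S^{m-1}$; 4. $I(\Delta^m_4)\simeq S^m$. -/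

import Mathlib

open scoped ContinuousMap

/-- The independence complex `I(G)` of a graph `G`: the abstract simplicial complex on the vertices
of `G` whose simplices are the (finite, nonempty) independent sets of `G`. -/
def independenceComplex {V : Type*} (G : SimpleGraph V) : AbstractSimplicialComplex V where
  faces := {s | s.Nonempty ∧ G.IsIndepSet (s : Set V)}
  isRelLowerSet_faces := by
    intro s hs
    refine ⟨hs.1, fun t hts ht => ⟨ht, ?_⟩⟩
    exact Set.Pairwise.mono (Finset.coe_subset.2 hts) hs.2
  singleton_mem := by
    intro v
    exact ⟨Finset.singleton_nonempty v, by simp⟩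

/-- The geometric realization of an abstract simplicial complex on a finite vertex set `V`, as a
subspace of `V → ℝ`: the points of the standard simplex, in barycentric coordinates, whose support
is contained in a face. -/
def geometricRealization {V : Type*} [Fintype V] (K : AbstractSimplicialComplex V) :
    Set (V → ℝ) :=
  {x | x ∈ stdSimplex ℝ V ∧ ∃ s ∈ K.faces, Function.support x ⊆ (s : Set V)}

/-- The vertices of `Δ^m_n`. Indices start from `0` here: for `i : Fin n`, `Sum.inl i` is the vertex
`e_{i+1}`, and for `i : Fin (n - 1)`, `k : Fin m`, `Sum.inr (i, k)` is the vertex `f^{k+1}_{i+1}`. -/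
abbrev DeltaVertex (m n : ℕ) : Type := Fin n ⊕ (Fin (n - 1) × Fin m)

/-- The graph `Δ^m_n`: the edges are `f^k_i ∼ f^k_{i+1}`, `e_i ∼ f^k_i` and `f^k_i ∼ e_{i+1}`. -/
def deltaGraph (m n : ℕ) : SimpleGraph (DeltaVertex m n) where
  Adj
    | Sum.inl _, Sum.inl _ => False
    | Sum.inl i, Sum.inr (j, _) => (i : ℕ) = j ∨ (i : ℕ) = j + 1
    | Sum.inr (j, _), Sum.inl i => (i : ℕ) = j ∨ (i : ℕ) = j + 1
    | Sum.inr (i, k), Sum.inr (j, l) => k = l ∧ ((i : ℕ) + 1 = j ∨ (j : ℕ) + 1 = i)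
  symm := ⟨by
    rintro (i | ⟨i, k⟩) (j | ⟨j, l⟩) h
    · exact h
    · exact h
    · exact h
    · exact ⟨h.1.symm, h.2.symm⟩⟩
  loopless := ⟨by
    rintro (i | ⟨i, k⟩) h
    · exact h
    · rcases h.2 with h | h <;> omega⟩

/-- The topological space `|I(Δ^m_n)|`. -/
abbrev DeltaSpace (m n : ℕ) : Type :=
  geometricRealization (independenceComplex (deltaGraph m n))

/-- The sphere `S^d`, the unit sphere in Euclidean space of dimension `d + 1`. -/
abbrev Sphere (d : ℕ) : Type := Metric.sphere (0 : EuclideanSpace ℝ (Fin (d + 1))) 1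

/-- The base point `(1, 0, …, 0)` of `S^d`. -/
noncomputable def Sphere.base (d : ℕ) : Sphere d :=
  ⟨EuclideanSpace.single 0 1, by simp⟩

/-- The wedge sum `X ∨ Y` of two pointed spaces: the quotient space of the disjoint union `X ⊕ Y`
in which the base points `x₀` and `y₀` are identified. -/
abbrev Wedge {X Y : Type*} (x₀ : X) (y₀ : Y) : Type _ :=
  Quot fun a b : X ⊕ Y => a = Sum.inl x₀ ∧ b = Sum.inr y₀

/-! The realization is replaced by the apex-free cone `independenceCone`: nonnegative nonzero
weights whose support is independent. Dropping the normalization of the total weight lets piecewise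
polynomial formulas serve as maps. Apart from the identification of the wedge with a subspace of a
product, every equivalence consists of two explicit maps that are inverse up to straight-line
homotopies. In a cone, such a homotopy exists once a point and its image are supported in a common
face.

For n = 2 every `e` is adjacent to every `f`, so the complex is two disjoint simplices. For n = 3, 4
a vertex whose neighbourhood contains that of another vertex can be folded onto it. This removes the
inner `e`'s and leaves two vertices a, b joined by m paths.

For n = 4 the paths are a - x k - y k - z k - b. Without a and b, each k contributes a point y k or
an edge x k z k, that is, an S^0 up to homotopy; their join is S^(m-1). The vertices a and b cone it
off from two sides, and the faces containing both add only the simplex on a, b and all y k. The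
result is a suspension, S^m (`nonempty_pathsCone_homotopyEquiv`).

For n = 3 the paths are a - x k - y k - b. The x k and y k span a cross-polytope, S^(m-1); a cones
off the face of all y k, b cones off the face of all x k, and a, b span an edge. Shrinking these
cones leaves a path y j - a - b - x i attached to the cross-polytope (`handleCone`). For i ≠ j its
ends span an edge of the cross-polytope, and contracting that edge gives S^1 ∨ S^(m-1). -/

/-! ### Straight-line homotopies, apex-free cones and spheres -/

theorem homotopic_id_of_segments {E : Type*} [AddCommGroup E] [Module ℝ E] [TopologicalSpace E]
    [IsTopologicalAddGroup E] [ContinuousSMul ℝ E] {X : Set E} (h : C(X, X))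
    (hX : ∀ x : X, ∀ s t : ℝ, 0 < s → 0 < t → s + t = 1 → s • (x : E) + t • (h x : E) ∈ X) :
    h.Homotopic (ContinuousMap.id X) := by
  refine ⟨⟨⟨fun p => ⟨(p.1 : ℝ) • (p.2 : E) + (1 - (p.1 : ℝ)) • (h p.2 : E), ?_⟩, ?_⟩, ?_, ?_⟩⟩
  · rcases p with ⟨⟨t, h0, h1⟩, x⟩
    rcases h0.eq_or_lt with rfl | h0
    · simp
    rcases h1.eq_or_lt with rfl | h1
    · simp
    exact hX x t (1 - t) h0 (by linarith) (by ring)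
  · fun_prop
  · intro x; simp
  · intro x; simp

/-- Maps between subsets of real vector spaces which are inverse to each other up to straight-line
homotopies yield a homotopy equivalence. -/
theorem nonempty_homotopyEquiv_of_segments {E F : Type*}
    [AddCommGroup E] [Module ℝ E] [TopologicalSpace E] [IsTopologicalAddGroup E]
    [ContinuousSMul ℝ E]
    [AddCommGroup F] [Module ℝ F] [TopologicalSpace F] [IsTopologicalAddGroup F]
    [ContinuousSMul ℝ F] {X : Set E} {Y : Set F} (f : E → F) (g : F → E)
    (hf : ContinuousOn f X) (hg : ContinuousOn g Y) (hfX : Set.MapsTo f X Y)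
    (hgY : Set.MapsTo g Y X)
    (hX : ∀ x ∈ X, ∀ s t : ℝ, 0 < s → 0 < t → s + t = 1 → s • x + t • g (f x) ∈ X)
    (hY : ∀ y ∈ Y, ∀ s t : ℝ, 0 < s → 0 < t → s + t = 1 → s • y + t • f (g y) ∈ Y) :
    Nonempty (X ≃ₕ Y) :=
  ⟨⟨⟨fun x => ⟨f x, hfX x.2⟩, (continuousOn_iff_continuous_domRestrict.1 hf).subtype_mk _⟩,
    ⟨fun y => ⟨g y, hgY y.2⟩, (continuousOn_iff_continuous_domRestrict.1 hg).subtype_mk _⟩,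
    homotopic_id_of_segments _ fun x s t hs ht h => hX x x.2 s t hs ht h,
    homotopic_id_of_segments _ fun y s t hs ht h => hY y y.2 s t hs ht h⟩⟩

/-- Nonnegative vectors cannot cancel, so a segment inside the positive orthant never meets the
missing apex. -/
theorem smul_add_smul_ne_zero {E : Type*} [AddCommGroup E] [PartialOrder E] [IsOrderedAddMonoid E]
    [Module ℝ E] [PosSMulStrictMono ℝ E] {x y : E} (hx : 0 ≤ x) (hx' : x ≠ 0) (hy : 0 ≤ y)
    {s t : ℝ} (hs : 0 < s) (ht : 0 < t) : s • x + t • y ≠ 0 :=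
  (add_pos_of_pos_of_nonneg (smul_pos hs (hx.lt_of_ne' hx')) (smul_nonneg ht.le hy)).ne'

/-- The cone, without its apex, over the realization of the independence complex of `G`. -/
def independenceCone {V : Type*} (G : SimpleGraph V) : Set (V → ℝ) :=
  {w | 0 ≤ w ∧ w ≠ 0 ∧ ∀ u v, G.Adj u v → w u = 0 ∨ w v = 0}

theorem mem_geometricRealization_independenceComplex {V : Type*} [Fintype V] {G : SimpleGraph V}
    {w : V → ℝ} : w ∈ geometricRealization (independenceComplex G) ↔
      w ∈ independenceCone G ∧ ∑ v, w v = 1 := by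
  classical
  constructor
  · rintro ⟨⟨h0, h1⟩, s, ⟨-, hs⟩, hws⟩
    refine ⟨⟨h0, ?_, fun u v huv => ?_⟩, h1⟩
    · rintro rfl
      simp at h1
    · by_contra! h
      exact hs (hws h.1) (hws h.2) huv.ne huv
  · rintro ⟨⟨h0, hne, hG⟩, h1⟩
    refine ⟨⟨h0, h1⟩, Finset.univ.filter fun v => w v ≠ 0, ⟨?_, ?_⟩, ?_⟩
    · obtain ⟨v, hv⟩ := Function.ne_iff.1 hne
      exact ⟨v, by simpa using hv⟩
    · intro u hu v hv _ huv
      have := hG u v huv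
      simp at hu hv
      tauto
    · intro v hv
      simpa using hv

theorem sum_pos_of_mem_independenceCone {V : Type*} [Fintype V] {G : SimpleGraph V} {w : V → ℝ}
    (hw : w ∈ independenceCone G) : 0 < ∑ v, w v := by
  obtain ⟨v, hv⟩ := Function.ne_iff.1 hw.2.1
  exact Finset.sum_pos' (fun u _ => hw.1 u) ⟨v, Finset.mem_univ v, (hw.1 v).lt_of_ne' hv⟩

/-- Radial projection: dividing by the total weight moves a point along its own ray, which stays in
the cone. -/
theorem nonempty_homotopyEquiv_independenceCone {V : Type*} [Fintype V] (G : SimpleGraph V) :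
    Nonempty (geometricRealization (independenceComplex G) ≃ₕ independenceCone G) := by
  have smul_mem : ∀ w ∈ independenceCone G, ∀ c : ℝ, 0 < c → c • w ∈ independenceCone G := by
    rintro w ⟨h0, hne, hG⟩ c hc
    refine ⟨smul_nonneg hc.le h0, smul_ne_zero hc.ne' hne, fun u v huv => ?_⟩
    rcases hG u v huv with h | h <;> simp [h]
  refine nonempty_homotopyEquiv_of_segments id (fun w => (∑ v, w v)⁻¹ • w) continuousOn_id
    ?_ (fun w hw => (mem_geometricRealization_independenceComplex.1 hw).1) ?_ ?_ ?_
  · refine ContinuousOn.smul (ContinuousOn.inv₀ (f := fun w : V → ℝ => ∑ v, w v)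
      (by fun_prop) fun w hw => ?_) continuousOn_id
    exact (sum_pos_of_mem_independenceCone hw).ne'
  · intro w hw
    have := sum_pos_of_mem_independenceCone hw
    refine mem_geometricRealization_independenceComplex.2
      ⟨smul_mem w hw _ (inv_pos.2 this), ?_⟩
    simp only [Pi.smul_apply, smul_eq_mul, ← Finset.mul_sum]
    field_simp
  · intro w hw s t hs ht hst
    have h := (mem_geometricRealization_independenceComplex.1 hw).2
    simpa [h, ← add_smul, hst] using hw
  · intro w hw s t hs ht _
    have := inv_pos.2 (sum_pos_of_mem_independenceCone hw)
    simp only [id, smul_smul, ← add_smul]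
    exact smul_mem w hw _ (by positivity)

theorem nonempty_homotopyEquiv_sphere {F : Type*} [NormedAddCommGroup F] [NormedSpace ℝ F]
    [FiniteDimensional ℝ F] (d : ℕ) (hd : Module.finrank ℝ F = d + 1) :
    Nonempty ({v : F | v ≠ 0} ≃ₕ Sphere d) := by
  have e : F ≃L[ℝ] EuclideanSpace ℝ (Fin (d + 1)) :=
    ContinuousLinearEquiv.ofFinrankEq (by simp [hd])
  refine nonempty_homotopyEquiv_of_segments (fun v => ‖e v‖⁻¹ • e v) e.symm ?_
    (by fun_prop) ?_ ?_ ?_ ?_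
  · refine ContinuousOn.smul (f := fun v => ‖e v‖⁻¹) (g := e)
      (ContinuousOn.inv₀ (f := fun v => ‖e v‖) (by fun_prop) fun v hv => ?_) (by fun_prop)
    simpa using hv
  · intro v hv
    have : ‖e v‖ ≠ 0 := by simpa using hv
    simp [norm_smul, this]
  · intro v hv
    simp at hv
    simp
    rintro rfl
    simp at hv
  · intro v hv s t hs ht _
    have : 0 < ‖e v‖ := by simpa using hv
    simp only [map_smul, e.symm_apply_apply, smul_smul, ← add_smul]
    exact smul_ne_zero (by positivity) hv
  · intro v hv s t hs ht hst
    have h : ‖v‖ = 1 := by simpa using hv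
    simp [h, ← add_smul, hst]

/-- The common-face condition for one edge of the graph: if the same endpoint has weight zero at
both ends of a segment, the constraint holds along the whole segment. -/
theorem comb_eq_zero_or {a a' b b' : ℝ} (h : a = 0 ∧ a' = 0 ∨ b = 0 ∧ b' = 0) (s t : ℝ) :
    s * a + t * a' = 0 ∨ s * b + t * b' = 0 := by
  rcases h with ⟨rfl, rfl⟩ | ⟨rfl, rfl⟩ <;> simp

/-! ### The graphs with n = 1 and n = 2 -/

theorem mem_independenceCone_deltaGraph {m n : ℕ} {w : DeltaVertex m n → ℝ} :
    w ∈ independenceCone (deltaGraph m n) ↔ 0 ≤ w ∧ w ≠ 0 ∧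
      (∀ (i : Fin n) (j : Fin (n - 1)) k, (i : ℕ) = j ∨ (i : ℕ) = j + 1 →
        w (.inl i) = 0 ∨ w (.inr (j, k)) = 0) ∧
      ∀ (i j : Fin (n - 1)) k, (i : ℕ) + 1 = j → w (.inr (i, k)) = 0 ∨ w (.inr (j, k)) = 0 := by
  refine and_congr_right fun _ => and_congr_right fun _ => ⟨fun h => ⟨?_, ?_⟩, ?_⟩
  · exact fun i j k hij => h (.inl i) (.inr (j, k)) hij
  · exact fun i j k hij => h (.inr (i, k)) (.inr (j, k)) ⟨rfl, .inl hij⟩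
  · rintro ⟨h₁, h₂⟩ (i | ⟨i, k⟩) (j | ⟨j, l⟩) hij
    · exact hij.elim
    · exact h₁ i j l hij
    · exact (h₁ j i k hij).symm
    · obtain ⟨rfl, h | h⟩ := hij
      · exact h₂ i j k h
      · exact (h₂ j i k h).symm

theorem nonempty_homeomorph_deltaSpace_one (m : ℕ) : Nonempty (DeltaSpace m 1 ≃ₜ PUnit.{1}) := by
  have h : ∀ w : DeltaVertex m 1 → ℝ,
      w ∈ geometricRealization (independenceComplex (deltaGraph m 1)) ↔ w = fun _ => 1 := by
    intro w
    rw [mem_geometricRealization_independenceComplex, mem_independenceCone_deltaGraph]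
    constructor
    · rintro ⟨-, h⟩
      ext (i | ⟨i, k⟩)
      · simpa [Subsingleton.elim i 0] using h
      · exact i.elim0
    · rintro rfl
      refine ⟨⟨fun _ => zero_le_one, fun h => one_ne_zero (congrFun h (.inl 0)), ?_, ?_⟩, by simp⟩
      · intro i j; exact j.elim0
      · intro i j; exact j.elim0
  let : Unique (DeltaSpace m 1) :=
    { default := ⟨fun _ => 1, (h _).2 rfl⟩
      uniq := fun w => Subtype.ext ((h _).1 w.2) }
  exact ⟨Homeomorph.homeomorphOfUnique _ _⟩

theorem nonempty_homotopyEquiv_deltaSpace_two (m : ℕ) (hm : 0 < m) :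
    Nonempty (DeltaSpace m 2 ≃ₕ Sphere 0) := by
  obtain ⟨e₁⟩ := nonempty_homotopyEquiv_independenceCone (deltaGraph m 2)
  obtain ⟨e₂⟩ := nonempty_homotopyEquiv_sphere (F := ℝ) 0 (by simp)
  have hmem : ∀ w : DeltaVertex m 2 → ℝ, w ∈ independenceCone (deltaGraph m 2) ↔
      0 ≤ w ∧ w ≠ 0 ∧ ∀ i k, w (.inl i) = 0 ∨ w (.inr (0, k)) = 0 := by
    intro w
    rw [mem_independenceCone_deltaGraph]
    simp [Fin.forall_fin_succ]
  have hsum : ∀ w ∈ independenceCone (deltaGraph m 2),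
      0 < ∑ i, w (.inl i) ∧ (∀ k, w (.inr (0, k)) = 0) ∨
      (∀ i, w (.inl i) = 0) ∧ 0 < ∑ k, w (.inr (0, k)) := by
    intro w hw
    have hpos := sum_pos_of_mem_independenceCone hw
    obtain ⟨h0, -, h⟩ := (hmem w).1 hw
    rw [Fintype.sum_sum_type, Fintype.sum_prod_type] at hpos
    by_cases hi : ∀ i, w (.inl i) = 0
    · right
      simpa [hi] using hpos
    · left
      push Not at hi
      obtain ⟨i, hi⟩ := hi
      exact ⟨Finset.sum_pos' (fun j _ => h0 _) ⟨i, Finset.mem_univ i, (h0 _).lt_of_ne' hi⟩,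
        fun k => (h i k).resolve_left hi⟩
  have e : Nonempty (independenceCone (deltaGraph m 2) ≃ₕ {s : ℝ | s ≠ 0}) := by
    -- The sign of the real number selects one of the two simplices, and all its vertices get equal
    -- weight. The round trip on `ℝ` multiplies by 2 or by m according to the sign, which is
    -- harmless since both are positive.
    refine nonempty_homotopyEquiv_of_segments
      (fun w => ∑ i, w (.inl i) - ∑ k, w (.inr (0, k)))
      (fun s => Sum.elim (fun _ => max s 0) (fun _ => max (-s) 0)) (by fun_prop) ?_ ?_ ?_ ?_ ?_
    · refine Continuous.continuousOn (continuous_pi ?_)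
      rintro (i | i)
      · simp only [Sum.elim_inl]; fun_prop
      · simp only [Sum.elim_inr]; fun_prop
    · intro w hw
      rcases hsum w hw with ⟨h₁, h₂⟩ | ⟨h₁, h₂⟩
      · simpa [h₂] using h₁.ne'
      · simpa [h₁] using h₂.ne'
    · intro s hs
      rw [hmem]
      refine ⟨?_, ?_, ?_⟩
      · rintro (i | i) <;> simp
      · intro h
        have h₁ := congrFun h (.inl 0)
        have h₂ := congrFun h (.inr (0, ⟨0, hm⟩))
        simp at h₁ h₂
        exact hs (le_antisymm h₁ h₂)
      · intro i k
        rcases le_total s 0 with h | h <;> simp [h]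
    · intro w hw s t hs ht _
      obtain ⟨h0, hne, h⟩ := (hmem w).1 hw
      rw [hmem]
      refine ⟨add_nonneg (smul_nonneg hs.le h0) (smul_nonneg ht.le ?_),
        smul_add_smul_ne_zero h0 hne ?_ hs ht, fun i k => comb_eq_zero_or ?_ s t⟩
      · rintro (i | i) <;> simp
      · rintro (i | i) <;> simp
      · rcases hsum w hw with ⟨h₁, h₂⟩ | ⟨h₁, h₂⟩
        · right; simpa [h₂, -Fin.sum_univ_two] using h₁.le
        · left; simpa [h₁] using h₂.le
    · intro r hr s t hs ht _
      have hm' : (0 : ℝ) < m := by exact_mod_cast hm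
      rcases lt_or_gt_of_ne hr with h | h
      · have h' : 0 < -r := by linarith
        simp [h.le]
        have h₁ := mul_pos hs h'
        have h₂ := mul_pos ht (mul_pos hm' h')
        intro h₃; nlinarith
      · simp [h.le]
        positivity
  exact ⟨(e₁.trans e.some).trans e₂⟩

/-! ### The graph with n = 4: a suspension -/

theorem add_eq_zero_or {a b c : ℝ} (h₁ : a = 0 ∨ c = 0) (h₂ : b = 0 ∨ c = 0) :
    a + b = 0 ∨ c = 0 := by
  rcases h₁ with rfl | h₁
  · simpa using h₂
  · exact .inr h₁

/-- The cone, without its apex, over the independence complex of the graph in which the vertices `a`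
and `b` are joined by paths `a - x k - y k - z k - b` indexed by `k : ι`. -/
def pathsCone (ι : Type*) : Set (ℝ × ℝ × (ι → ℝ) × (ι → ℝ) × (ι → ℝ)) :=
  {p | 0 ≤ p ∧ p ≠ 0 ∧ ∀ k, (p.1 = 0 ∨ p.2.2.1 k = 0) ∧ (p.2.2.1 k = 0 ∨ p.2.2.2.1 k = 0) ∧
    (p.2.2.2.1 k = 0 ∨ p.2.2.2.2 k = 0) ∧ (p.2.2.2.2 k = 0 ∨ p.2.1 = 0)}

/-- Two folds: neighbours of `e_1` are neighbours of `e_2`, and neighbours of `e_4` are neighbours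
of `e_3`, so the weights of the inner vertices can be moved to the outer ones without leaving a
face. -/
theorem nonempty_homotopyEquiv_pathsCone (m : ℕ) :
    Nonempty (independenceCone (deltaGraph m 4) ≃ₕ pathsCone (Fin m)) := by
  have hmem : ∀ w : DeltaVertex m 4 → ℝ, w ∈ independenceCone (deltaGraph m 4) ↔
      0 ≤ w ∧ w ≠ 0 ∧ ∀ k, (w (.inl 0) = 0 ∨ w (.inr ((0 : Fin 3), k)) = 0) ∧
        (w (.inl 1) = 0 ∨ w (.inr ((0 : Fin 3), k)) = 0) ∧
        (w (.inl 1) = 0 ∨ w (.inr ((1 : Fin 3), k)) = 0) ∧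
        (w (.inl 2) = 0 ∨ w (.inr ((1 : Fin 3), k)) = 0) ∧
        (w (.inl 2) = 0 ∨ w (.inr ((2 : Fin 3), k)) = 0) ∧
        (w (.inl 3) = 0 ∨ w (.inr ((2 : Fin 3), k)) = 0) ∧
        (w (.inr ((0 : Fin 3), k)) = 0 ∨ w (.inr ((1 : Fin 3), k)) = 0) ∧
        (w (.inr ((1 : Fin 3), k)) = 0 ∨ w (.inr ((2 : Fin 3), k)) = 0) := by
    intro w
    rw [mem_independenceCone_deltaGraph]
    simp [Fin.forall_fin_succ, forall_and]
    tauto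
  let f : (DeltaVertex m 4 → ℝ) → ℝ × ℝ × (Fin m → ℝ) × (Fin m → ℝ) × (Fin m → ℝ) := fun w =>
    (w (.inl 0) + w (.inl 1), w (.inl 2) + w (.inl 3), fun k => w (.inr ((0 : Fin 3), k)),
      fun k => w (.inr ((1 : Fin 3), k)), fun k => w (.inr ((2 : Fin 3), k)))
  let g : ℝ × ℝ × (Fin m → ℝ) × (Fin m → ℝ) × (Fin m → ℝ) → DeltaVertex m 4 → ℝ := fun p =>
    Sum.elim ![p.1, 0, 0, p.2.1]
      fun v => (![p.2.2.1 v.2, p.2.2.2.1 v.2, p.2.2.2.2 v.2] : Fin 3 → ℝ) v.1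
  have hfg : ∀ p, f (g p) = p := fun p => by simp [f, g]
  have hf0 : ∀ w, 0 ≤ w → 0 ≤ f w := fun w hw =>
    ⟨add_nonneg (hw _) (hw _), add_nonneg (hw _) (hw _), fun _ => hw _, fun _ => hw _, fun _ => hw _⟩
  have hg0 : ∀ p, 0 ≤ p → 0 ≤ g p := by
    rintro p ⟨ha, hb, hx, hy, hz⟩ (i | ⟨i, k⟩)
    · fin_cases i <;> first | exact ha | exact hb | exact le_rfl
    · change Fin 3 at i
      fin_cases i
      exacts [hx k, hy k, hz k]
  have hmaps : Set.MapsTo f (independenceCone (deltaGraph m 4)) (pathsCone (Fin m)) := by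
    intro w hw
    obtain ⟨h0, hne, h⟩ := (hmem w).1 hw
    refine ⟨hf0 w h0, fun h' => ?_, fun k => ?_⟩
    · simp only [f, Prod.ext_iff, funext_iff] at h'
      obtain ⟨h₁, h₂, h₃, h₄, h₅⟩ := h'
      have h₁ := (add_eq_zero_iff_of_nonneg (h0 _) (h0 _)).1 h₁
      have h₂ := (add_eq_zero_iff_of_nonneg (h0 _) (h0 _)).1 h₂
      refine hne (funext ?_)
      rintro (i | ⟨i, k⟩)
      · fin_cases i
        exacts [h₁.1, h₁.2, h₂.1, h₂.2]
      · change Fin 3 at i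
        fin_cases i
        exacts [h₃ k, h₄ k, h₅ k]
    · obtain ⟨h₀₀, h₁₀, -, -, h₂₂, h₃₂, h₀₁, h₁₂⟩ := h k
      exact ⟨add_eq_zero_or h₀₀ h₁₀, h₀₁, h₁₂, (add_eq_zero_or h₂₂ h₃₂).symm⟩
  refine nonempty_homotopyEquiv_of_segments f g ?_ ?_ hmaps ?_ ?_ ?_
  · simp only [f]; fun_prop
  · refine Continuous.continuousOn (continuous_pi ?_)
    rintro (i | ⟨i, k⟩)
    · fin_cases i <;> simp [g] <;> fun_prop
    · change Fin 3 at i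
      fin_cases i <;> simp [g] <;> fun_prop
  · rintro p ⟨h0, hne, h⟩
    rw [hmem]
    refine ⟨hg0 p h0, fun h' => hne ?_, fun k => ?_⟩
    · rw [← hfg p, h']; simp [f, Prod.ext_iff, funext_iff]
    · have := h k
      simp [g]
      tauto
  · intro w hw s t hs ht _
    obtain ⟨h0, hne, h⟩ := (hmem w).1 hw
    obtain ⟨h0', -, -⟩ := hmaps hw
    rw [hmem]
    refine ⟨add_nonneg (smul_nonneg hs.le h0) (smul_nonneg ht.le (hg0 _ h0')),
      smul_add_smul_ne_zero h0 hne (hg0 _ h0') hs ht, fun k => ?_⟩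
    obtain ⟨h₀₀, h₁₀, h₁₁, h₂₁, h₂₂, h₃₂, h₀₁, h₁₂⟩ := h k
    have hA := add_eq_zero_or h₀₀ h₁₀
    have hB := add_eq_zero_or h₂₂ h₃₂
    refine ⟨comb_eq_zero_or ?_ s t, comb_eq_zero_or ?_ s t, comb_eq_zero_or ?_ s t,
      comb_eq_zero_or ?_ s t, comb_eq_zero_or ?_ s t, comb_eq_zero_or ?_ s t,
      comb_eq_zero_or ?_ s t, comb_eq_zero_or ?_ s t⟩ <;>
      simp only [f, g, Sum.elim_inl, Sum.elim_inr, Matrix.cons_val, and_self, and_true]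
    exacts [and_or_right.2 ⟨h₀₀, hA⟩, h₁₀, h₁₁, h₂₁, h₂₂, and_or_right.2 ⟨h₃₂, hB⟩, h₀₁, h₁₂]
  · intro p hp s t hs ht hst
    rw [hfg, ← add_smul, hst, one_smul]
    exact hp

/-- This keeps the weights of a and x k produced from a vector apart: a is positive only for s > T,
and there d - s is already negative. -/
theorem max_eq_zero_or_min_eq_zero {d T : ℝ} (hd : 0 ≤ d) (hdT : d ≤ T) (s : ℝ) :
    max (s - T) 0 = 0 ∨ min (2 * d) (max (d - s) 0) = 0 := by
  rcases le_total s T with h | h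
  · exact .inl (max_eq_right (by linarith))
  · right
    rw [max_eq_right (by linarith), min_eq_right (by linarith)]

set_option maxHeartbeats 1000000 in
-- The first coordinate is the suspension direction, with a and z on the positive side and b and x
-- on the negative side. Coordinate k of the second factor is positive on y k and negative on x k
-- and z k.
theorem nonempty_pathsCone_homotopyEquiv (ι : Type*) [Fintype ι] [Nonempty ι] :
    Nonempty (pathsCone ι ≃ₕ {v : ℝ × (ι → ℝ) | v ≠ 0}) := by
  -- The term `min p.1 p.2.1` pushes the faces containing both a and b, whose other vertices are
  -- y's, into the positive orthant, away from the origin.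
  let f : ℝ × ℝ × (ι → ℝ) × (ι → ℝ) × (ι → ℝ) → ℝ × (ι → ℝ) := fun p =>
    (p.1 - p.2.1 + ∑ k, (p.2.2.2.2 k - p.2.2.1 k),
      fun k => p.2.2.2.1 k - p.2.2.1 k - p.2.2.2.2 k + min p.1 p.2.1)
  -- The negative part d of `v.2 k` is shared between x k and z k according to `v.1`, with total 2 *
  -- d; hence the factor 2 on y k. The vertices a and b appear only once `|v.1|` exceeds the sum of
  -- all negative parts.
  let g : ℝ × (ι → ℝ) → ℝ × ℝ × (ι → ℝ) × (ι → ℝ) × (ι → ℝ) := fun v =>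
    (max (v.1 - ∑ k, max (-v.2 k) 0) 0, max (-v.1 - ∑ k, max (-v.2 k) 0) 0,
      fun k => min (2 * max (-v.2 k) 0) (max (max (-v.2 k) 0 - v.1) 0),
      fun k => 2 * max (v.2 k) 0,
      fun k => min (2 * max (-v.2 k) 0) (max (max (-v.2 k) 0 - -v.1) 0))
  have hg0 : ∀ v, 0 ≤ g v := fun v =>
    ⟨by simp [g], by simp [g], fun k => by simp [g], fun k => by simp [g], fun k => by simp [g]⟩
  have hle : ∀ (c : ι → ℝ), 0 ≤ c → ∀ k, c k ≤ ∑ k, c k := fun c hc k =>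
    Finset.single_le_sum (f := c) (fun i _ => hc i) (Finset.mem_univ k)
  have hneg0 : ∀ v : ι → ℝ, 0 ≤ fun k => max (-v k) 0 := fun v k => le_max_right _ _
  have hmaps : Set.MapsTo g {v : ℝ × (ι → ℝ) | v ≠ 0} (pathsCone ι) := by
    rintro ⟨s, v⟩ hv
    refine ⟨hg0 _, fun h => hv ?_, fun k => ?_⟩
    · simp only [g, Prod.ext_iff, funext_iff] at h
      obtain ⟨ha, hb, hx, hy, hz⟩ := h
      have hv0 : ∀ k, v k = 0 := by
        intro k
        have hxk := hx k
        have hyk := hy k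
        have hzk := hz k
        simp at hxk hyk hzk
        grind
      simp [hv0] at ha hb
      exact Prod.ext (le_antisymm ha hb) (funext hv0)
    · have hk := hle _ (hneg0 v) k
      have hk0 := hneg0 v k
      have hc : max (-v k) 0 = 0 ∨ max (v k) 0 = 0 := by grind
      refine ⟨max_eq_zero_or_min_eq_zero hk0 hk s, ?_, ?_,
        (max_eq_zero_or_min_eq_zero hk0 hk (-s)).symm⟩
      · simp only [g]
        rcases hc with hc | hc <;> simp [hc]
      · simp only [g]
        rcases hc with hc | hc <;> simp [hc]
  refine nonempty_homotopyEquiv_of_segments f g ?_ ?_ ?_ hmaps ?_ ?_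
  · simp only [f]; fun_prop
  · simp only [g]; fun_prop
  · rintro ⟨a, b, x, y, z⟩ ⟨⟨ha, hb, hx, hy, hz⟩, hne, h⟩ hv
    simp only [f, Prod.ext_iff, funext_iff] at hv h
    obtain ⟨hs, ht⟩ := hv
    change 0 ≤ a at ha
    change 0 ≤ b at hb
    simp only [Prod.fst_zero, Prod.snd_zero, Pi.zero_apply] at hs ht
    -- If just one of a, b is positive, the first coordinate has its sign. If both are, every x and
    -- z vanishes and each second coordinate is at least `min a b`, so an index k is needed. If
    -- neither is, the second coordinates determine that x, y, z vanish.
    rcases ha.eq_or_lt with rfl | ha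
    · rcases hb.eq_or_lt with rfl | hb
      · have : ∀ k, x k = 0 ∧ y k = 0 ∧ z k = 0 := by
          intro k
          have h1 := ht k
          have h2 := hx k
          have h3 := hy k
          have h4 := hz k
          simp at h1 h2 h3 h4
          obtain ⟨-, h5, h6, -⟩ := h k
          grind
        exact hne (by ext k <;> simp [this])
      · have hz' : ∀ k, z k = 0 := fun k => ((h k).2.2.2).resolve_right hb.ne'
        have : 0 ≤ ∑ k, x k := Finset.sum_nonneg fun k _ => hx k
        simp [hz'] at hs
        linarith
    · have hx' : ∀ k, x k = 0 := fun k => ((h k).1).resolve_left ha.ne'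
      rcases hb.eq_or_lt with rfl | hb
      · have : 0 ≤ ∑ k, z k := Finset.sum_nonneg fun k _ => hz k
        simp [hx'] at hs
        linarith
      · have hz' : ∀ k, z k = 0 := fun k => ((h k).2.2.2).resolve_right hb.ne'
        obtain ⟨k⟩ := ‹Nonempty ι›
        have h1 := ht k
        have h2 : 0 ≤ y k := hy k
        have h3 : 0 < min a b := lt_min ha hb
        simp only [hx', hz'] at h1
        linarith
  · rintro p ⟨h0, hne, h⟩ s t hs ht _
    refine ⟨add_nonneg (smul_nonneg hs.le h0) (smul_nonneg ht.le (hg0 _)),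
      smul_add_smul_ne_zero h0 hne (hg0 _) hs ht, fun k => ?_⟩
    obtain ⟨a, b, x, y, z⟩ := p
    obtain ⟨ha, hb, hx, hy, hz⟩ := h0
    change 0 ≤ a at ha
    change 0 ≤ b at hb
    simp only at h hx hy hz
    let S : ℝ := a - b + ∑ k, (z k - x k)
    let c : ι → ℝ := fun k => y k - x k - z k + min a b
    let d : ι → ℝ := fun k => max (-c k) 0
    have hd : 0 ≤ d := hneg0 c
    have small : ∀ r : ℝ, d k ≤ r → min (2 * d k) (max (d k - r) 0) = 0 := fun r hr => by
      have : 0 ≤ d k := hd k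
      rw [max_eq_right (sub_nonpos.2 hr), min_eq_right (by positivity)]
    have zero : ∀ r : ℝ, d k = 0 → min (2 * d k) (max (d k - r) 0) = 0 := fun r hr => by simp [hr]
    suffices hk : (a = 0 ∧ max (S - ∑ k, d k) 0 = 0 ∨
          x k = 0 ∧ min (2 * d k) (max (d k - S) 0) = 0) ∧
        (x k = 0 ∧ min (2 * d k) (max (d k - S) 0) = 0 ∨ y k = 0 ∧ 2 * max (c k) 0 = 0) ∧
        (y k = 0 ∧ 2 * max (c k) 0 = 0 ∨ z k = 0 ∧ min (2 * d k) (max (d k - -S) 0) = 0) ∧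
        (z k = 0 ∧ min (2 * d k) (max (d k - -S) 0) = 0 ∨
          b = 0 ∧ max (-S - ∑ k, d k) 0 = 0) from
      ⟨comb_eq_zero_or hk.1 s t, comb_eq_zero_or hk.2.1 s t, comb_eq_zero_or hk.2.2.1 s t,
        comb_eq_zero_or hk.2.2.2 s t⟩
    have hck : c k = y k - x k - z k + min a b := rfl
    have hdk : d k = max (-c k) 0 := rfl
    have hxk : 0 ≤ x k := hx k
    have hyk : 0 ≤ y k := hy k
    have hzk : 0 ≤ z k := hz k
    have hT : 0 ≤ ∑ k, d k := Finset.sum_nonneg fun k _ => hd k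
    obtain ⟨-, hxy, hyz, -⟩ := h k
    -- For a = b = 0, `d` is x + z, so |S| is at most the sum of `d` and a, b stay zero. If exactly
    -- one is positive, |S| exceeds that sum and the x's or z's that must vanish do. If both are,
    -- `min a b` makes `c k` positive, hence `d k` zero.
    rcases ha.eq_or_lt with rfl | ha <;> rcases hb.eq_or_lt with rfl | hb
    · have hd' : ∀ k, d k = x k + z k := by
        intro k
        obtain ⟨-, h5, h6, -⟩ := h k
        have h2 : 0 ≤ x k := hx k
        have h3 : 0 ≤ y k := hy k
        have h4 : 0 ≤ z k := hz k
        simp only [d, c]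
        grind
      have h1 : S ≤ ∑ k, d k := by
        simp only [S, sub_self, zero_add, hd']
        exact Finset.sum_le_sum fun k _ => by have : 0 ≤ x k := hx k; linarith
      have h2 : -S ≤ ∑ k, d k := by
        simp only [S, sub_self, zero_add, hd', ← Finset.sum_neg_distrib]
        exact Finset.sum_le_sum fun k _ => by have : 0 ≤ z k := hz k; linarith
      refine ⟨.inl ⟨rfl, max_eq_right (by linarith)⟩, ?_, ?_,
        .inr ⟨rfl, max_eq_right (by linarith)⟩⟩
      · rcases eq_or_ne (y k) 0 with h3 | h3
        · exact .inr ⟨h3, by rw [max_eq_right (by simp at hck; linarith), mul_zero]⟩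
        · refine .inl ⟨hxy.resolve_right h3, zero _ ?_⟩
          rw [hd', hxy.resolve_right h3, hyz.resolve_left h3, add_zero]
      · rcases eq_or_ne (y k) 0 with h3 | h3
        · exact .inl ⟨h3, by rw [max_eq_right (by simp at hck; linarith), mul_zero]⟩
        · refine .inr ⟨hyz.resolve_left h3, zero _ ?_⟩
          rw [hd', hxy.resolve_right h3, hyz.resolve_left h3, add_zero]
    · have hz0 : ∀ k, z k = 0 := fun k => ((h k).2.2.2).resolve_right hb.ne'
      have hmin : min 0 b = 0 := min_eq_left hb.le
      have h1 : ∑ k, d k < -S := by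
        have : ∑ k, d k ≤ ∑ k, x k := Finset.sum_le_sum fun k _ =>
          max_le (by have : 0 ≤ y k := hy k; simp [c, hz0, hmin, this]) (hx k)
        simp [S, hz0]
        linarith
      have h2 := (hle d hd k).trans h1.le
      refine ⟨.inl ⟨rfl, max_eq_right (by linarith)⟩, ?_, .inr ⟨hz0 k, small _ h2⟩,
        .inl ⟨hz0 k, small _ h2⟩⟩
      rcases hxy with h3 | h3
      · exact .inl ⟨h3, zero _ (by rw [hdk, hck, h3, hz0, hmin]; simpa using hyk)⟩
      · exact .inr ⟨h3, by rw [hck, h3, hz0, hmin, max_eq_right (by simpa using hxk), mul_zero]⟩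
    · have hx0 : ∀ k, x k = 0 := fun k => ((h k).1).resolve_left ha.ne'
      have hmin : min a 0 = 0 := min_eq_right ha.le
      have h1 : ∑ k, d k < S := by
        have : ∑ k, d k ≤ ∑ k, z k := Finset.sum_le_sum fun k _ =>
          max_le (by have : 0 ≤ y k := hy k; simp [c, hx0, hmin, this]) (hz k)
        simp [S, hx0]
        linarith
      have h2 := (hle d hd k).trans h1.le
      refine ⟨.inr ⟨hx0 k, small _ h2⟩, .inl ⟨hx0 k, small _ h2⟩, ?_,
        .inr ⟨rfl, max_eq_right (by linarith)⟩⟩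
      rcases hyz with h3 | h3
      · exact .inl ⟨h3, by rw [hck, h3, hx0, hmin, max_eq_right (by simpa using hzk), mul_zero]⟩
      · exact .inr ⟨h3, zero _ (by rw [hdk, hck, h3, hx0, hmin]; simpa using hyk)⟩
    · have hx0 : x k = 0 := ((h k).1).resolve_left ha.ne'
      have hz0 : z k = 0 := ((h k).2.2.2).resolve_right hb.ne'
      have h1 : d k = 0 := by
        have := lt_min ha hb
        rw [hdk, hck, hx0, hz0]
        exact max_eq_right (by linarith)
      exact ⟨.inr ⟨hx0, zero _ h1⟩, .inl ⟨hx0, zero _ h1⟩, .inr ⟨hz0, zero _ h1⟩,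
        .inl ⟨hz0, zero _ h1⟩⟩
  · rintro ⟨r, v⟩ hv s t hs ht _ h
    let d : ι → ℝ := fun k => max (-v k) 0
    have hd : 0 ≤ d := hneg0 v
    let e : ι → ℝ → ℝ := fun k r => min (2 * d k) (max (d k - r) 0)
    have he : ∀ k, Antitone (e k) := fun k r r' hr =>
      min_le_min_left _ (max_le_max_right _ (sub_le_sub_left hr _))
    have hT : 0 ≤ ∑ k, d k := Finset.sum_nonneg fun k _ => hd k
    have h1 : s * r + t * (max (r - ∑ k, d k) 0 - max (-r - ∑ k, d k) 0 +
        ∑ k, (e k (-r) - e k r)) = 0 := congrArg Prod.fst h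
    have h2 : ∀ k, s * v k + t * (2 * max (v k) 0 - e k r - e k (-r) +
        min (max (r - ∑ k, d k) 0) (max (-r - ∑ k, d k) 0)) = 0 :=
      fun k => congrFun (congrArg Prod.snd h) k
    -- The round trip never reverses the sign of the first coordinate, so only r = 0 could be
    -- critical; there x k = z k = `d k` and the second factor is simply doubled.
    rcases lt_trichotomy r 0 with hr | rfl | hr
    · have h3 : ∑ k, (e k (-r) - e k r) ≤ 0 :=
        Finset.sum_nonpos fun k _ => sub_nonpos.2 (he k (by linarith))
      have h4 : max (r - ∑ k, d k) 0 = 0 := max_eq_right (by linarith)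
      have h5 := le_max_right (-r - ∑ k, d k) 0
      have := mul_neg_of_pos_of_neg hs hr
      have := mul_nonpos_of_nonneg_of_nonpos ht.le (by linarith :
        max (r - ∑ k, d k) 0 - max (-r - ∑ k, d k) 0 + ∑ k, (e k (-r) - e k r) ≤ 0)
      linarith
    · refine hv (Prod.ext rfl (funext fun k => ?_))
      have h3 := h2 k
      have h4 : e k 0 = d k := by
        have : 0 ≤ d k := hd k
        simp only [e, sub_zero, max_eq_left this]
        exact min_eq_right (by linarith)
      have h5 : max (v k) 0 - d k = v k := by
        simp only [d]
        grind
      have h6 : max (0 - ∑ k, d k) 0 = 0 := max_eq_right (by linarith)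
      rw [neg_zero, h4, h6, min_self] at h3
      have h7 : (s + 2 * t) * v k = 0 := by linear_combination h3 - 2 * t * h5
      exact (mul_eq_zero.1 h7).resolve_left (by positivity)
    · have h3 : 0 ≤ ∑ k, (e k (-r) - e k r) :=
        Finset.sum_nonneg fun k _ => sub_nonneg.2 (he k (by linarith))
      have h4 : max (-r - ∑ k, d k) 0 = 0 := max_eq_right (by linarith)
      have h5 := le_max_right (r - ∑ k, d k) 0
      have := mul_pos hs hr
      have := mul_nonneg ht.le (by linarith :
        0 ≤ max (r - ∑ k, d k) 0 - max (-r - ∑ k, d k) 0 + ∑ k, (e k (-r) - e k r))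
      linarith

theorem nonempty_homotopyEquiv_deltaSpace_four (m : ℕ) (hm : 0 < m) :
    Nonempty (DeltaSpace m 4 ≃ₕ Sphere m) := by
  have : Nonempty (Fin m) := ⟨⟨0, hm⟩⟩
  obtain ⟨e₁⟩ := nonempty_homotopyEquiv_independenceCone (deltaGraph m 4)
  obtain ⟨e₂⟩ := nonempty_homotopyEquiv_pathsCone m
  obtain ⟨e₃⟩ := nonempty_pathsCone_homotopyEquiv (Fin m)
  obtain ⟨e₄⟩ := nonempty_homotopyEquiv_sphere (F := ℝ × (Fin m → ℝ)) m (by simp [add_comm])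
  exact ⟨((e₁.trans e₂).trans e₃).trans e₄⟩

/-! ### Wedges of spheres as spaces of pairs of vectors -/

/-- Pairs of nonzero vectors, at least one of which is on the ray through `p` or `q`,
respectively. -/
def wedgeCone {E F : Type*} [AddCommGroup E] [Module ℝ E] [AddCommGroup F] [Module ℝ F] (p : E)
    (q : F) : Set (E × F) :=
  {w | w.1 ≠ 0 ∧ w.2 ≠ 0 ∧ ((∃ c : ℝ, 0 < c ∧ w.1 = c • p) ∨ ∃ c : ℝ, 0 < c ∧ w.2 = c • q)}

/-- The wedge of two spheres as a subspace of their product. -/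
def sphereWedge (d d' : ℕ) :
    Set (EuclideanSpace ℝ (Fin (d + 1)) × EuclideanSpace ℝ (Fin (d' + 1))) :=
  {w | ‖w.1‖ = 1 ∧ ‖w.2‖ = 1 ∧
    (w.1 = EuclideanSpace.single 0 1 ∨ w.2 = EuclideanSpace.single 0 1)}

/-- The quotient of a compact space maps continuously and bijectively to a Hausdorff one. Working
inside a product makes straight-line homotopies available for the wedge. -/
theorem nonempty_wedge_homeomorph_sphereWedge (d d' : ℕ) :
    Nonempty (Wedge (Sphere.base d) (Sphere.base d') ≃ₜ sphereWedge d d') := by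
  let f : Sphere d ⊕ Sphere d' → sphereWedge d d' := Sum.elim
    (fun x => ⟨(x, EuclideanSpace.single 0 1), by simp, by simp, .inr rfl⟩)
    (fun y => ⟨(EuclideanSpace.single 0 1, y), by simp, by simp, .inl rfl⟩)
  have hf : Continuous f := by
    refine Continuous.sumElim ?_ ?_ <;> fun_prop
  let g : Wedge (Sphere.base d) (Sphere.base d') → sphereWedge d d' :=
    Quot.lift f (by rintro _ _ ⟨rfl, rfl⟩; rfl)
  have hg : Continuous g := continuous_quot_lift _ hf
  have hbase : Quot.mk (fun a b : Sphere d ⊕ Sphere d' =>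
        a = Sum.inl (Sphere.base d) ∧ b = Sum.inr (Sphere.base d')) (Sum.inl (Sphere.base d)) =
      Quot.mk _ (Sum.inr (Sphere.base d')) := Quot.sound ⟨rfl, rfl⟩
  have hinj : Function.Injective g := by
    have hlr : ∀ x y, f (.inl x) = f (.inr y) → x = Sphere.base d ∧ y = Sphere.base d' := by
      intro x y h
      have h' := congrArg Subtype.val h
      exact ⟨Subtype.ext (congrArg Prod.fst h'), (Subtype.ext (congrArg Prod.snd h')).symm⟩
    rintro ⟨x | y⟩ ⟨x' | y'⟩ h
    · have h' := congrArg (fun w => w.1.1) h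
      exact congrArg (fun x => Quot.mk _ (Sum.inl x)) (Subtype.ext h')
    · obtain ⟨rfl, rfl⟩ := hlr x y' h
      exact hbase
    · obtain ⟨rfl, rfl⟩ := hlr x' y h.symm
      exact hbase.symm
    · have h' := congrArg (fun w => w.1.2) h
      exact congrArg (fun x => Quot.mk _ (Sum.inr x)) (Subtype.ext h')
  have hsurj : Function.Surjective g := by
    rintro ⟨⟨u, v⟩, hu, hv, h | h⟩
    · exact ⟨Quot.mk _ (.inr ⟨v, by simpa using hv⟩), Subtype.ext (Prod.ext h.symm rfl)⟩
    · exact ⟨Quot.mk _ (.inl ⟨u, by simpa using hu⟩), Subtype.ext (Prod.ext rfl h.symm)⟩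
  exact ⟨hg.homeoOfEquivCompactToT2 (f := Equiv.ofBijective g ⟨hinj, hsurj⟩)⟩

theorem exists_continuousLinearEquiv_euclideanSpace {F : Type*} [NormedAddCommGroup F]
    [NormedSpace ℝ F] [FiniteDimensional ℝ F] {d : ℕ} (hd : Module.finrank ℝ F = d + 1) {p : F}
    (hp : p ≠ 0) :
    ∃ e : F ≃L[ℝ] EuclideanSpace ℝ (Fin (d + 1)), e p = EuclideanSpace.single 0 1 := by
  let e : F ≃L[ℝ] EuclideanSpace ℝ (Fin (d + 1)) :=
    ContinuousLinearEquiv.ofFinrankEq (by simp [hd])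
  obtain ⟨A, hA⟩ := SeparatingDual.exists_continuousLinearEquiv_apply_eq (R := ℝ)
    (x := e p) (y := EuclideanSpace.single 0 1) (by simpa using hp) (by simp)
  exact ⟨e.trans A, hA⟩

/-- Linear isomorphisms taking `p` and `q` to the base points reduce this to normalizing the two
factors separately, which collapses each distinguished ray to a base point. -/
theorem nonempty_wedgeCone_homotopyEquiv_wedge {E F : Type*} [NormedAddCommGroup E]
    [NormedSpace ℝ E] [FiniteDimensional ℝ E] [NormedAddCommGroup F] [NormedSpace ℝ F]
    [FiniteDimensional ℝ F] {d d' : ℕ} (hd : Module.finrank ℝ E = d + 1)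
    (hd' : Module.finrank ℝ F = d' + 1) {p : E} {q : F} (hp : p ≠ 0) (hq : q ≠ 0) :
    Nonempty (wedgeCone p q ≃ₕ Wedge (Sphere.base d) (Sphere.base d')) := by
  obtain ⟨φ, hφ⟩ := exists_continuousLinearEquiv_euclideanSpace hd hp
  obtain ⟨ψ, hψ⟩ := exists_continuousLinearEquiv_euclideanSpace hd' hq
  obtain ⟨e₂⟩ := nonempty_wedge_homeomorph_sphereWedge d d'
  have e₁ : Nonempty (wedgeCone p q ≃ₕ sphereWedge d d') := by
    refine nonempty_homotopyEquiv_of_segments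
      (fun w => (‖φ w.1‖⁻¹ • φ w.1, ‖ψ w.2‖⁻¹ • ψ w.2)) (fun w => (φ.symm w.1, ψ.symm w.2))
      ?_ (by fun_prop) ?_ ?_ ?_ ?_
    · refine ContinuousOn.prodMk
        (ContinuousOn.smul (f := fun w : E × F => ‖φ w.1‖⁻¹) (g := fun w => φ w.1)
          (ContinuousOn.inv₀ (f := fun w : E × F => ‖φ w.1‖) (by fun_prop) fun w hw => ?_)
          (by fun_prop))
        (ContinuousOn.smul (f := fun w : E × F => ‖ψ w.2‖⁻¹) (g := fun w => ψ w.2)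
          (ContinuousOn.inv₀ (f := fun w : E × F => ‖ψ w.2‖) (by fun_prop) fun w hw => ?_)
          (by fun_prop))
      · simpa using hw.1
      · simpa using hw.2.1
    · rintro ⟨u, v⟩ ⟨hu, hv, h⟩
      have hu' : ‖φ u‖ ≠ 0 := by simpa using hu
      have hv' : ‖ψ v‖ ≠ 0 := by simpa using hv
      refine ⟨by simp [norm_smul, hu'], by simp [norm_smul, hv'], ?_⟩
      rcases h with ⟨c, hc, h⟩ | ⟨c, hc, h⟩
      · left
        simp only at h
        simp [h, hφ, norm_smul, smul_smul, abs_of_pos hc, hc.ne']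
      · right
        simp only at h
        simp [h, hψ, norm_smul, smul_smul, abs_of_pos hc, hc.ne']
    · rintro ⟨u, v⟩ ⟨hu, hv, h⟩
      simp only at hu hv h
      refine ⟨?_, ?_, ?_⟩
      · have : u ≠ 0 := by rintro rfl; simp at hu
        simpa using this
      · have : v ≠ 0 := by rintro rfl; simp at hv
        simpa using this
      · rcases h with rfl | rfl
        · exact .inl ⟨1, one_pos, by simp [← hφ]⟩
        · exact .inr ⟨1, one_pos, by simp [← hψ]⟩
    · rintro ⟨u, v⟩ ⟨hu, hv, h⟩ s t hs ht _
      simp only at hu hv h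
      have hu' : 0 < ‖φ u‖ := by simpa using hu
      have hv' : 0 < ‖ψ v‖ := by simpa using hv
      have h1 : 0 < s + t * ‖φ u‖⁻¹ := by positivity
      have h2 : 0 < s + t * ‖ψ v‖⁻¹ := by positivity
      simp only [map_smul, φ.symm_apply_apply, ψ.symm_apply_apply, Prod.smul_mk, Prod.mk_add_mk,
        smul_smul, ← add_smul]
      refine ⟨smul_ne_zero h1.ne' hu, smul_ne_zero h2.ne' hv, ?_⟩
      rcases h with ⟨c, hc, rfl⟩ | ⟨c, hc, rfl⟩
      · exact .inl ⟨_, mul_pos h1 hc, smul_smul _ _ _⟩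
      · exact .inr ⟨_, mul_pos h2 hc, smul_smul _ _ _⟩
    · rintro ⟨u, v⟩ hw s t hs ht hst
      obtain ⟨hu, hv, -⟩ := id hw
      simp only at hu hv
      simpa [hu, hv, ← add_smul, hst] using hw
  exact ⟨e₁.some.trans e₂.symm.toHomotopyEquiv⟩

/-! ### The graph with n = 3: a cross-polytope with a handle -/

/-- The cone, without its apex, over the independence complex of the graph in which the vertices `a`
and `b` are joined by paths `a - x k - y k - b` indexed by `k : ι`. -/
def shortPathsCone (ι : Type*) : Set (ℝ × ℝ × (ι → ℝ) × (ι → ℝ)) :=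
  {p | 0 ≤ p ∧ p ≠ 0 ∧ ∀ k, (p.1 = 0 ∨ p.2.2.1 k = 0) ∧ (p.2.1 = 0 ∨ p.2.2.2 k = 0) ∧
    (p.2.2.1 k = 0 ∨ p.2.2.2 k = 0)}

/-- The cone, without its apex, over the union of a cross-polytope and a path which joins its
vertices `x i` and `y j`. -/
def handleCone {ι : Type*} (i j : ι) : Set (ℝ × ℝ × (ι → ℝ) × (ι → ℝ)) :=
  {p | p ∈ shortPathsCone ι ∧ ∀ k, (k ≠ i → p.2.1 = 0 ∨ p.2.2.1 k = 0) ∧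
    (k ≠ j → p.1 = 0 ∨ p.2.2.2 k = 0)}

/-- The nonzero vectors on the edge from `i` to the negative of `j` of the cross-polytope. -/
def edgeCone {ι : Type*} (i j : ι) : Set (ι → ℝ) :=
  {v | v ≠ 0 ∧ 0 ≤ v i ∧ v j ≤ 0 ∧ ∀ k, k ≠ i → k ≠ j → v k = 0}

/-- Pairs of nonzero vectors, the first of which is on the positive axis or the second of which
is on an edge of the cross-polytope. -/
def edgeWedgeCone {ι : Type*} (i j : ι) : Set ((ℝ × ℝ) × (ι → ℝ)) :=
  {w | (0 < w.1.1 ∧ w.1.2 = 0 ∧ w.2 ≠ 0) ∨ (w.1 ≠ 0 ∧ w.2 ∈ edgeCone i j)}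

/-- The signs prescribed at i and j rule out cancellation. The vector `v'` may vanish, as may `t`.
-/
theorem smul_add_smul_mem_edgeCone {ι : Type*} {i j : ι} {v v' : ι → ℝ} (hv : v ∈ edgeCone i j)
    (hi : 0 ≤ v' i) (hj : v' j ≤ 0) (h : ∀ k, k ≠ i → k ≠ j → v' k = 0) {s t : ℝ} (hs : 0 < s)
    (ht : 0 ≤ t) : s • v + t • v' ∈ edgeCone i j := by
  obtain ⟨hne, hi', hj', h'⟩ := hv
  have h1 : 0 ≤ s * v i := mul_nonneg hs.le hi'
  have h2 : s * v j ≤ 0 := mul_nonpos_of_nonneg_of_nonpos hs.le hj'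
  have h3 : 0 ≤ t * v' i := mul_nonneg ht hi
  have h4 : t * v' j ≤ 0 := mul_nonpos_of_nonneg_of_nonpos ht hj
  refine ⟨fun h0 => hne (funext fun k => ?_), ?_, ?_, fun k hki hkj => by simp [h, h', hki, hkj]⟩
  · have hi0 : s * v i + t * v' i = 0 := congrFun h0 i
    have hj0 : s * v j + t * v' j = 0 := congrFun h0 j
    by_cases hki : k = i
    · subst hki
      exact (mul_eq_zero.1 (by linarith : s * v k = 0)).resolve_left hs.ne'
    by_cases hkj : k = j
    · subst hkj
      exact (mul_eq_zero.1 (by linarith : s * v k = 0)).resolve_left hs.ne'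
    exact h' k hki hkj
  · simp only [Pi.add_apply, Pi.smul_apply, smul_eq_mul]; linarith
  · simp only [Pi.add_apply, Pi.smul_apply, smul_eq_mul]; linarith

/-- This contracts the edge to the ray of its midpoint direction `q`. To extend the contraction
continuously to the other sphere, it is spread over the sector |u.2| ≤ u.1, which is flattened onto
the positive axis. -/
theorem nonempty_homotopyEquiv_wedgeCone {ι : Type*} [DecidableEq ι] {i j : ι} (hij : i ≠ j) :
    Nonempty (edgeWedgeCone i j ≃ₕ
      wedgeCone ((1, 0) : ℝ × ℝ) (Pi.single i 1 - Pi.single j 1 : ι → ℝ)) := by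
  let q : ι → ℝ := Pi.single i 1 - Pi.single j 1
  have hqi : q i = 1 := by simp [q, hij]
  have hqj : q j = -1 := by simp [q, hij.symm]
  have hq : ∀ k, k ≠ i → k ≠ j → q k = 0 := fun k hi hj => by simp [q, hi, hj]
  have hq0 : q ∈ edgeCone i j := ⟨fun h => by simp [h] at hqi, by simp [hqi], by simp [hqj], hq⟩
  -- `κ` vanishes on the sector. `τ`, the weight kept by v, is positive only in its interior, and
  -- `θ`, the weight of `q`, vanishes only on the nonnegative axis. So at each point the first
  -- factor is on its ray or the second is on the ray of `q`.
  let κ : ℝ × ℝ → ℝ := fun u => max (u.2 - max u.1 0) 0 - max (-u.2 - max u.1 0) 0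
  let τ : ℝ × ℝ → ℝ := fun u => max (u.1 - |u.2|) 0
  let θ : ℝ × ℝ → ℝ := fun u => |u.2| + max (-u.1) 0
  let f : (ℝ × ℝ) × (ι → ℝ) → (ℝ × ℝ) × (ι → ℝ) := fun w =>
    ((w.1.1, κ w.1), τ w.1 • w.2 + θ w.1 • q)
  have hτ : ∀ u, 0 ≤ τ u := fun u => le_max_right _ _
  have hθ : ∀ u, 0 ≤ θ u := fun u => add_nonneg (abs_nonneg _) (le_max_right _ _)
  have hpos : ∀ u, u ≠ 0 → θ u = 0 → 0 < τ u := by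
    rintro ⟨a, b⟩ hu h
    simp only [θ, τ] at h ⊢
    have hb : |b| = 0 := by have := abs_nonneg b; have := le_max_right (-a) 0; linarith
    rw [hb] at h ⊢
    rw [zero_add, max_eq_right_iff] at h
    have hb' : b = 0 := abs_eq_zero.1 hb
    have : a ≠ 0 := fun ha => hu (by simp [ha, hb'])
    have : 0 < a := lt_of_le_of_ne (by linarith) this.symm
    simp [this]
  have hκ0 : ∀ b, κ (0, b) = b := by
    intro b
    simp only [κ, max_self, sub_zero]
    rcases le_total b 0 with h | h <;> simp [h]
  have hκ : ∀ u, 0 < τ u → 0 < u.1 ∧ κ u = 0 := by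
    rintro ⟨a, b⟩ h
    simp only [τ, lt_max_iff, lt_irrefl, or_false, sub_pos] at h
    have ha : 0 < a := (abs_nonneg b).trans_lt h
    have := abs_lt.1 h
    refine ⟨ha, ?_⟩
    simp only [κ, max_eq_left ha.le]
    rw [max_eq_right (by linarith), max_eq_right (by linarith), sub_zero]
  have hray : ∀ u : ℝ × ℝ, 0 < u.1 → u.2 = 0 → κ u = 0 ∧ τ u = u.1 ∧ θ u = 0 := by
    rintro ⟨a, b⟩ ha hb
    simp only at ha hb
    simp [κ, τ, θ, hb, ha.le]
  have hu0 : ∀ u : ℝ × ℝ, u ≠ 0 → ∀ s t : ℝ, 0 ≤ s → 0 < t →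
      s • u + t • (u.1, κ u) ≠ 0 := by
    rintro ⟨a, b⟩ hu s t hs ht h
    have h1 : s * a + t * a = 0 := congrArg Prod.fst h
    have h2 : s * b + t * κ (a, b) = 0 := congrArg Prod.snd h
    rw [← add_mul] at h1
    obtain rfl := (mul_eq_zero.1 h1).resolve_left (by positivity)
    rw [hκ0, ← add_mul] at h2
    exact hu (Prod.ext rfl ((mul_eq_zero.1 h2).resolve_left (by positivity)))
  have hN : ∀ u, u ≠ 0 → ∀ v ∈ edgeCone i j, τ u • v + θ u • q ∈ edgeCone i j := by
    intro u hu v hv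
    rcases (hτ u).eq_or_lt with h | h
    · have h' : 0 < θ u := (hθ u).lt_of_ne' fun h' => (hpos u hu h').ne h
      rw [add_comm]
      exact smul_add_smul_mem_edgeCone hq0 hv.2.1 hv.2.2.1 hv.2.2.2 h' (hτ u)
    · exact smul_add_smul_mem_edgeCone hv hq0.2.1 hq0.2.2.1 hq0.2.2.2 h (hθ u)
  refine nonempty_homotopyEquiv_of_segments f id ?_ continuousOn_id ?_ ?_ ?_ ?_
  · simp only [f, κ, τ, θ]; fun_prop
  · rintro ⟨u, v⟩ (⟨hu, hu', hv⟩ | ⟨hu, hv⟩)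
    · obtain ⟨h1, h2, h3⟩ := hray u hu hu'
      simp only [f, h1, h2, h3, zero_smul, add_zero]
      refine ⟨fun h => hu.ne' (congrArg Prod.fst h), smul_ne_zero hu.ne' hv, .inl ⟨_, hu, ?_⟩⟩
      simp
    · refine ⟨fun h => hu0 u hu 0 1 le_rfl one_pos (by rw [zero_smul, zero_add, one_smul]; exact h),
        (hN u hu v hv).1, ?_⟩
      simp only [f]
      rcases (hτ u).eq_or_lt with h | h
      · exact .inr ⟨θ u, (hθ u).lt_of_ne' fun h' => (hpos u hu h').ne h, by simp [← h, q]⟩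
      · exact .inl ⟨u.1, (hκ u h).1, by simp [(hκ u h).2]⟩
  · rintro ⟨u, v⟩ ⟨hu, hv, ⟨c, hc, rfl⟩ | ⟨c, hc, rfl⟩⟩
    · exact .inl ⟨by simpa using hc, by simp, hv⟩
    · refine .inr ⟨hu, ?_⟩
      simpa using smul_add_smul_mem_edgeCone hq0 le_rfl le_rfl (v' := 0) (fun _ _ _ => rfl) hc le_rfl
  · rintro ⟨u, v⟩ (⟨hu, hu', hv⟩ | ⟨hu, hv⟩) s t hs ht _
    · obtain ⟨h1, h2, h3⟩ := hray u hu hu'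
      simp only at hu hu' hv
      simp only [id, f, h1, h2, h3, zero_smul, add_zero]
      refine .inl ⟨?_, ?_, ?_⟩
      · simp; positivity
      · simp [hu']
      · simp only [Prod.smul_mk, Prod.mk_add_mk, smul_smul, ← add_smul]
        exact smul_ne_zero (by positivity) hv
    · have h := hN u hu v hv
      exact .inr ⟨hu0 u hu s t hs.le ht, smul_add_smul_mem_edgeCone hv h.2.1 h.2.2.1 h.2.2.2 hs ht.le⟩
  · rintro ⟨u, v⟩ ⟨hu, hv, h⟩ s t hs ht _
    simp only at hu hv h
    rcases h with ⟨c, hc, h⟩ | ⟨c, hc, h⟩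
    · have hu1 : 0 < u.1 := by simpa [h] using hc
      have hu2 : u.2 = 0 := by simp [h]
      obtain ⟨h1, h2, h3⟩ := hray u hu1 hu2
      simp only [id, f, h1, h2, h3, zero_smul, add_zero]
      refine ⟨h1 ▸ hu0 u hu s t hs.le ht, ?_, .inl ⟨s * u.1 + t * u.1, by positivity, ?_⟩⟩
      · simp only [Prod.smul_mk, Prod.mk_add_mk, smul_smul, ← add_smul]
        exact smul_ne_zero (by positivity) hv
      · ext <;> simp [hu2]
    · obtain rfl : v = c • q := h
      simp only [id, f, Prod.smul_mk, Prod.mk_add_mk, smul_smul, ← add_smul]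
      have h4 : 0 < τ u * c + θ u := by
        rcases (hθ u).eq_or_lt with h | h
        · have := hpos u hu h.symm
          rw [← h]
          positivity
        · have := hτ u
          positivity
      have h5 : 0 < s * c + t * (τ u * c + θ u) := by positivity
      exact ⟨hu0 u hu s t hs.le ht, smul_ne_zero h5.ne' hq0.1, .inr ⟨_, h5, rfl⟩⟩

/-- One fold suffices: neighbours of `e_1` are neighbours of `e_2`, so the weight of `e_2` moves to
`e_1`. -/
theorem nonempty_homotopyEquiv_shortPathsCone (m : ℕ) :
    Nonempty (independenceCone (deltaGraph m 3) ≃ₕ shortPathsCone (Fin m)) := by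
  have hmem : ∀ w : DeltaVertex m 3 → ℝ, w ∈ independenceCone (deltaGraph m 3) ↔
      0 ≤ w ∧ w ≠ 0 ∧ ∀ k, (w (.inl 0) = 0 ∨ w (.inr ((0 : Fin 2), k)) = 0) ∧
        (w (.inl 1) = 0 ∨ w (.inr ((0 : Fin 2), k)) = 0) ∧
        (w (.inl 1) = 0 ∨ w (.inr ((1 : Fin 2), k)) = 0) ∧
        (w (.inl 2) = 0 ∨ w (.inr ((1 : Fin 2), k)) = 0) ∧
        (w (.inr ((0 : Fin 2), k)) = 0 ∨ w (.inr ((1 : Fin 2), k)) = 0) := by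
    intro w
    rw [mem_independenceCone_deltaGraph]
    simp [Fin.forall_fin_succ, forall_and]
    tauto
  let f : (DeltaVertex m 3 → ℝ) → ℝ × ℝ × (Fin m → ℝ) × (Fin m → ℝ) := fun w =>
    (w (.inl 0) + w (.inl 1), w (.inl 2), fun k => w (.inr ((0 : Fin 2), k)),
      fun k => w (.inr ((1 : Fin 2), k)))
  let g : ℝ × ℝ × (Fin m → ℝ) × (Fin m → ℝ) → DeltaVertex m 3 → ℝ := fun p =>
    Sum.elim ![p.1, 0, p.2.1] fun v => (![p.2.2.1 v.2, p.2.2.2 v.2] : Fin 2 → ℝ) v.1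
  have hfg : ∀ p, f (g p) = p := fun p => by simp [f, g]
  have hf0 : ∀ w, 0 ≤ w → 0 ≤ f w := fun w hw =>
    ⟨add_nonneg (hw _) (hw _), hw _, fun _ => hw _, fun _ => hw _⟩
  have hg0 : ∀ p, 0 ≤ p → 0 ≤ g p := by
    rintro p ⟨ha, hb, hx, hy⟩ (i | ⟨i, k⟩)
    · fin_cases i <;> first | exact ha | exact hb | exact le_rfl
    · change Fin 2 at i
      fin_cases i
      exacts [hx k, hy k]
  have hmaps : Set.MapsTo f (independenceCone (deltaGraph m 3)) (shortPathsCone (Fin m)) := by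
    intro w hw
    obtain ⟨h0, hne, h⟩ := (hmem w).1 hw
    refine ⟨hf0 w h0, fun h' => ?_, fun k => ?_⟩
    · simp only [f, Prod.ext_iff, funext_iff] at h'
      obtain ⟨h₁, h₂, h₃, h₄⟩ := h'
      have h₁ := (add_eq_zero_iff_of_nonneg (h0 _) (h0 _)).1 h₁
      refine hne (funext ?_)
      rintro (i | ⟨i, k⟩)
      · fin_cases i
        exacts [h₁.1, h₁.2, h₂]
      · change Fin 2 at i
        fin_cases i
        exacts [h₃ k, h₄ k]
    · obtain ⟨h₀₀, h₁₀, -, h₂₁, h₀₁⟩ := h k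
      exact ⟨add_eq_zero_or h₀₀ h₁₀, h₂₁, h₀₁⟩
  refine nonempty_homotopyEquiv_of_segments f g ?_ ?_ hmaps ?_ ?_ ?_
  · simp only [f]; fun_prop
  · refine Continuous.continuousOn (continuous_pi ?_)
    rintro (i | ⟨i, k⟩)
    · fin_cases i <;> simp [g] <;> fun_prop
    · change Fin 2 at i
      fin_cases i <;> simp [g] <;> fun_prop
  · rintro p ⟨h0, hne, h⟩
    rw [hmem]
    refine ⟨hg0 p h0, fun h' => hne ?_, fun k => ?_⟩
    · rw [← hfg p, h']; simp [f, Prod.ext_iff, funext_iff]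
    · have := h k
      simp [g]
      tauto
  · intro w hw s t hs ht _
    obtain ⟨h0, hne, h⟩ := (hmem w).1 hw
    obtain ⟨h0', -, -⟩ := hmaps hw
    rw [hmem]
    refine ⟨add_nonneg (smul_nonneg hs.le h0) (smul_nonneg ht.le (hg0 _ h0')),
      smul_add_smul_ne_zero h0 hne (hg0 _ h0') hs ht, fun k => ?_⟩
    obtain ⟨h₀₀, h₁₀, h₁₁, h₂₁, h₀₁⟩ := h k
    have hA := add_eq_zero_or h₀₀ h₁₀
    refine ⟨comb_eq_zero_or ?_ s t, comb_eq_zero_or ?_ s t, comb_eq_zero_or ?_ s t,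
      comb_eq_zero_or ?_ s t, comb_eq_zero_or ?_ s t⟩ <;>
      simp only [f, g, Sum.elim_inl, Sum.elim_inr, Matrix.cons_val, and_self, and_true]
    exacts [and_or_right.2 ⟨h₀₀, hA⟩, h₁₀, h₁₁, h₂₁, h₀₁]
  · intro p hp s t hs ht hst
    rw [hfg, ← add_smul, hst, one_smul]
    exact hp

/-- The cone from b over the face of all x's is squeezed onto the segment from b to x i by
contracting that face towards x i near b; likewise for a, the y's and y j. -/
theorem nonempty_shortPathsCone_homotopyEquiv_handleCone {ι : Type*} [Fintype ι] [DecidableEq ι]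
    (i j : ι) : Nonempty (shortPathsCone ι ≃ₕ handleCone i j) := by
  let σ : ℝ × ℝ × (ι → ℝ) × (ι → ℝ) → ℝ := fun p => ∑ k, (p.2.2.1 k + p.2.2.2 k)
  -- The threshold is b = σ: below it the new b is zero, above it the original x's have faded out
  -- and only x i remains. The same holds for a and y j.
  let f : ℝ × ℝ × (ι → ℝ) × (ι → ℝ) → ℝ × ℝ × (ι → ℝ) × (ι → ℝ) := fun p =>
    (max (p.1 - σ p) 0, max (p.2.1 - σ p) 0,
      fun k => max (σ p - p.2.1) 0 * p.2.2.1 k + σ p * p.2.1 * (Pi.single i 1 : ι → ℝ) k,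
      fun k => max (σ p - p.1) 0 * p.2.2.2 k + σ p * p.1 * (Pi.single j 1 : ι → ℝ) k)
  have hσ : ∀ p, 0 ≤ p → 0 ≤ σ p := fun p hp =>
    Finset.sum_nonneg fun k _ => add_nonneg (hp.2.2.1 k) (hp.2.2.2 k)
  have hδ : ∀ i k : ι, 0 ≤ (Pi.single i 1 : ι → ℝ) k := fun i k =>
    (Pi.single_nonneg.2 zero_le_one : (0 : ι → ℝ) ≤ Pi.single i 1) k
  have hf0 : ∀ p, 0 ≤ p → 0 ≤ f p := fun p hp =>
    ⟨le_max_right _ _, le_max_right _ _,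
      fun k => add_nonneg (mul_nonneg (le_max_right _ _) (hp.2.2.1 k))
        (mul_nonneg (mul_nonneg (hσ p hp) hp.2.1) (hδ i k)),
      fun k => add_nonneg (mul_nonneg (le_max_right _ _) (hp.2.2.2 k))
        (mul_nonneg (mul_nonneg (hσ p hp) hp.1) (hδ j k))⟩
  have ha : ∀ p, 0 ≤ p → p.1 = 0 → (f p).1 = 0 := fun p hp h => by
    have := hσ p hp
    simp only [f, h]
    exact max_eq_right (by linarith)
  have hb : ∀ p, 0 ≤ p → p.2.1 = 0 → (f p).2.1 = 0 := fun p hp h => by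
    have := hσ p hp
    simp only [f, h]
    exact max_eq_right (by linarith)
  have hσ0 : ∀ p ∈ shortPathsCone ι, p.1 = 0 ∨ p.2.1 = 0 ∨ σ p = 0 := by
    rintro p ⟨-, -, h⟩
    by_contra! h'
    exact h'.2.2 (Finset.sum_eq_zero fun k _ => by
      rw [(h k).1.resolve_left h'.1, (h k).2.1.resolve_left h'.2.1, add_zero])
  have hx : ∀ p ∈ shortPathsCone ι, p.1 ≠ 0 → ∀ k, p.2.2.1 k = 0 ∧ (f p).2.2.1 k = 0 := by
    intro p hp hp1 k
    have h1 := (hp.2.2 k).1.resolve_left hp1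
    refine ⟨h1, ?_⟩
    rcases (hσ0 p hp).resolve_left hp1 with h | h <;> simp [f, h1, h]
  have hy : ∀ p ∈ shortPathsCone ι, p.2.1 ≠ 0 → ∀ k, p.2.2.2 k = 0 ∧ (f p).2.2.2 k = 0 := by
    intro p hp hp1 k
    have h1 := (hp.2.2 k).2.1.resolve_left hp1
    refine ⟨h1, ?_⟩
    rcases hσ0 p hp with h | h | h
    · simp [f, h1, h]
    · exact absurd h hp1
    · simp [f, h1, h]
  have key : ∀ p ∈ shortPathsCone ι, ∀ k,
      (p.1 = 0 ∧ (f p).1 = 0 ∨ p.2.2.1 k = 0 ∧ (f p).2.2.1 k = 0) ∧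
      (p.2.1 = 0 ∧ (f p).2.1 = 0 ∨ p.2.2.2 k = 0 ∧ (f p).2.2.2 k = 0) ∧
      (p.2.2.1 k = 0 ∧ (f p).2.2.1 k = 0 ∨ p.2.2.2 k = 0 ∧ (f p).2.2.2 k = 0) := by
    intro p hp k
    by_cases h1 : p.1 = 0
    · by_cases h2 : p.2.1 = 0
      · refine ⟨.inl ⟨h1, ha p hp.1 h1⟩, .inl ⟨h2, hb p hp.1 h2⟩, ?_⟩
        exact (hp.2.2 k).2.2.imp (fun h => ⟨h, by simp [f, h, h2]⟩) fun h => ⟨h, by simp [f, h, h1]⟩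
      · exact ⟨.inl ⟨h1, ha p hp.1 h1⟩, .inr (hy p hp h2 k), .inr (hy p hp h2 k)⟩
    · refine ⟨.inr (hx p hp h1 k), ?_, .inl (hx p hp h1 k)⟩
      by_cases h2 : p.2.1 = 0
      · exact .inl ⟨h2, hb p hp.1 h2⟩
      · exact .inr (hy p hp h2 k)
  have seg : ∀ p ∈ shortPathsCone ι, ∀ s t : ℝ, 0 < s → 0 < t →
      s • p + t • f p ∈ shortPathsCone ι := fun p hp s t hs ht =>
    ⟨add_nonneg (smul_nonneg hs.le hp.1) (smul_nonneg ht.le (hf0 _ hp.1)),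
      smul_add_smul_ne_zero hp.1 hp.2.1 (hf0 _ hp.1) hs ht, fun k =>
      ⟨comb_eq_zero_or (key p hp k).1 s t, comb_eq_zero_or (key p hp k).2.1 s t,
        comb_eq_zero_or (key p hp k).2.2 s t⟩⟩
  refine nonempty_homotopyEquiv_of_segments f id ?_ continuousOn_id ?_ (fun p hp => hp.1)
    (fun p hp s t hs ht _ => seg p hp s t hs ht) ?_
  · simp only [f, σ]; fun_prop
  · rintro p hp
    have hp0 := hp.1
    have h0 := hσ p hp0
    have h1 : 0 ≤ p.1 := hp0.1
    have h2 : 0 ≤ p.2.1 := hp0.2.1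
    refine ⟨⟨hf0 _ hp0, fun h => hp.2.1 ?_, fun k => ?_⟩, fun k => ⟨fun hk => ?_, fun hk => ?_⟩⟩
    · have h3 : p.1 ≤ σ p := sub_nonpos.1 (max_eq_right_iff.1 (congrArg Prod.fst h))
      have h4 : p.2.1 ≤ σ p := sub_nonpos.1 (max_eq_right_iff.1 (congrArg (fun q => q.2.1) h))
      have hx' : ∀ k, (f p).2.2.1 k = 0 := fun k => by rw [h]; rfl
      have hy' : ∀ k, (f p).2.2.2 k = 0 := fun k => by rw [h]; rfl
      have hσ' : σ p = 0 := by
        by_contra hne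
        have hpos : 0 < σ p := h0.lt_of_ne' hne
        have h5 := (add_eq_zero_iff_of_nonneg (mul_nonneg (le_max_right _ _) (hp0.2.2.1 i))
          (mul_nonneg (mul_nonneg h0 h2) (hδ i i))).1 (hx' i)
        have h6 := (add_eq_zero_iff_of_nonneg (mul_nonneg (le_max_right _ _) (hp0.2.2.2 j))
          (mul_nonneg (mul_nonneg h0 h1) (hδ j j))).1 (hy' j)
        have hb0 : p.2.1 = 0 := by simpa [hne] using h5.2
        have ha0 : p.1 = 0 := by simpa [hne] using h6.2
        refine hne (Finset.sum_eq_zero fun k _ => ?_)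
        have h7 := hx' k
        have h8 := hy' k
        simp [f, ha0, hb0, max_eq_left h0, hne] at h7 h8
        rw [h7, h8, add_zero]
      have hxy : ∀ k, p.2.2.1 k = 0 ∧ p.2.2.2 k = 0 := fun k =>
        (add_eq_zero_iff_of_nonneg (hp0.2.2.1 k) (hp0.2.2.2 k)).1
          ((Finset.sum_eq_zero_iff_of_nonneg
            fun k _ => add_nonneg (hp0.2.2.1 k) (hp0.2.2.2 k)).1 hσ' k (Finset.mem_univ k))
      exact Prod.ext (by change p.1 = 0; linarith) (Prod.ext (by change p.2.1 = 0; linarith)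
        (Prod.ext (funext fun k => (hxy k).1) (funext fun k => (hxy k).2)))
    · exact ⟨(key p hp k).1.imp And.right And.right, (key p hp k).2.1.imp And.right And.right,
        (key p hp k).2.2.imp And.right And.right⟩
    · rcases le_total p.2.1 (σ p) with h | h
      · exact .inl (max_eq_right (by linarith))
      · right
        simp [f, hk, h]
    · rcases le_total p.1 (σ p) with h | h
      · exact .inl (max_eq_right (by linarith))
      · right
        simp [f, hk, h]
  · rintro p ⟨hp, h⟩ s t hs ht _
    refine ⟨seg p hp s t hs ht, fun k => ⟨fun hk => comb_eq_zero_or ?_ s t,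
      fun hk => comb_eq_zero_or ?_ s t⟩⟩
    · exact ((h k).1 hk).imp (fun h => ⟨h, hb p hp.1 h⟩) fun h => ⟨h, by simp [f, h, hk]⟩
    · exact ((h k).2 hk).imp (fun h => ⟨h, ha p hp.1 h⟩) fun h => ⟨h, by simp [f, h, hk]⟩

/-- The path y j - a - b - x i and the edge from x i to y j form a circle. The planar factor records
the position around it, with the cross-polytope over the positive axis; the other factor folds the
path onto the edge. -/
theorem nonempty_handleCone_homotopyEquiv_edgeWedgeCone {ι : Type*} [Fintype ι] [DecidableEq ι]
    {i j : ι} (hij : i ≠ j) : Nonempty (handleCone i j ≃ₕ edgeWedgeCone i j) := by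
  let δ : ι → ι → ℝ := fun i => Pi.single i 1
  have hδ : ∀ i k : ι, 0 ≤ δ i k := fun i k =>
    (Pi.single_nonneg.2 zero_le_one : (0 : ι → ℝ) ≤ Pi.single i 1) k
  have hδ1 : ∀ i, δ i i = 1 := fun i => Pi.single_eq_same i 1
  have hδ0 : ∀ i k, k ≠ i → δ i k = 0 := fun i k h => Pi.single_eq_of_ne h 1
  -- In the second factor a acts as y j and b as x i. In the plane, a = b > 0 forces the x's and y's
  -- to vanish, and the point lands on the negative axis.
  let f : ℝ × ℝ × (ι → ℝ) × (ι → ℝ) → (ℝ × ℝ) × (ι → ℝ) := fun p =>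
    ((∑ k, (p.2.2.1 k + p.2.2.2 k) - min p.1 p.2.1, p.1 - p.2.1),
      fun k => p.2.2.1 k - p.2.2.2 k + p.2.1 * δ i k - p.1 * δ j k)
  -- By the time a appears (`w.1.2 > w.1.1`) the x's have faded out, and similarly for b and the
  -- y's. The product terms supply y j and x i on the way, so that the image is nonzero even where
  -- `w.2` contributes nothing.
  let g : (ℝ × ℝ) × (ι → ℝ) → ℝ × ℝ × (ι → ℝ) × (ι → ℝ) := fun w =>
    (max (w.1.2 - w.1.1) 0, max (-w.1.2 - w.1.1) 0,
      fun k => max (w.1.1 - max w.1.2 0) 0 * max (w.2 k) 0 +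
        max w.1.1 0 * max (-w.1.2) 0 * δ i k,
      fun k => max (w.1.1 - max (-w.1.2) 0) 0 * max (-w.2 k) 0 +
        max w.1.1 0 * max w.1.2 0 * δ j k)
  have hg0 : ∀ w, 0 ≤ g w := fun w =>
    ⟨le_max_right _ _, le_max_right _ _,
      fun k => add_nonneg (mul_nonneg (le_max_right _ _) (le_max_right _ _))
        (mul_nonneg (mul_nonneg (le_max_right _ _) (le_max_right _ _)) (hδ i k)),
      fun k => add_nonneg (mul_nonneg (le_max_right _ _) (le_max_right _ _))
        (mul_nonneg (mul_nonneg (le_max_right _ _) (le_max_right _ _)) (hδ j k))⟩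
  have hgray : ∀ w : (ℝ × ℝ) × (ι → ℝ), 0 < w.1.1 → w.1.2 = 0 →
      g w = (0, 0, fun k => w.1.1 * max (w.2 k) 0, fun k => w.1.1 * max (-w.2 k) 0) := by
    rintro ⟨⟨a, b⟩, v⟩ ha hb
    simp only at ha hb
    simp [g, hb, ha.le]
  have hfedge : ∀ p, 0 ≤ p → p.2.2.1 j = 0 → p.2.2.2 i = 0 →
      (∀ k, k ≠ i → k ≠ j → p.2.2.1 k = 0 ∧ p.2.2.2 k = 0) →
      p.2.1 + p.2.2.1 i ≤ (f p).2 i ∧ (f p).2 j ≤ -p.1 - p.2.2.2 j ∧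
        ∀ k, k ≠ i → k ≠ j → (f p).2 k = 0 := by
    intro p hp hxj hyi h
    refine ⟨?_, ?_, fun k hki hkj => ?_⟩
    · simp only [f, hδ1, hδ0 j i hij, hyi]; linarith
    · simp only [f, hδ1, hδ0 i j hij.symm, hxj]; linarith
    · simp [f, hδ0, hki, hkj, h k hki hkj]
  have hgedge : ∀ u, ∀ v ∈ edgeCone i j, (g (u, v)).2.2.1 j = 0 ∧ (g (u, v)).2.2.2 i = 0 ∧
      ∀ k, k ≠ i → k ≠ j → (g (u, v)).2.2.1 k = 0 ∧ (g (u, v)).2.2.2 k = 0 := by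
    rintro u v ⟨-, hi, hj, h⟩
    refine ⟨?_, ?_, fun k hki hkj => ?_⟩
    · simp [g, hδ0 i j hij.symm, hj]
    · simp [g, hδ0 j i hij, hi]
    · simp [g, hδ0, hki, hkj, h k hki hkj]
  have hgx : ∀ w : (ℝ × ℝ) × (ι → ℝ), (g w).1 ≠ 0 → ∀ k, (g w).2.2.1 k = 0 := by
    rintro ⟨⟨a, b⟩, v⟩ h k
    have hab : a < b := by
      by_contra! hab
      exact h (max_eq_right (sub_nonpos.2 hab))
    have h1 : max (a - max b 0) 0 = 0 := max_eq_right (by have := le_max_left b 0; linarith)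
    have h2 : max a 0 * max (-b) 0 = 0 := by
      rcases le_total a 0 with h | h
      · simp [h]
      · rw [max_eq_right (by linarith : -b ≤ 0), mul_zero]
    simp only [g, h1, h2, zero_mul, add_zero]
  have hgy : ∀ w : (ℝ × ℝ) × (ι → ℝ), (g w).2.1 ≠ 0 → ∀ k, (g w).2.2.2 k = 0 := by
    rintro ⟨⟨a, b⟩, v⟩ h k
    have hab : a < -b := by
      by_contra! hab
      exact h (max_eq_right (sub_nonpos.2 hab))
    have h1 : max (a - max (-b) 0) 0 = 0 := max_eq_right (by have := le_max_left (-b) 0; linarith)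
    have h2 : max a 0 * max b 0 = 0 := by
      rcases le_total a 0 with h | h
      · simp [h]
      · rw [max_eq_right (by linarith : b ≤ 0), mul_zero]
    simp only [g, h1, h2, zero_mul, add_zero]
  have hfedge' : ∀ p ∈ handleCone i j, p.1 ≠ 0 ∨ p.2.1 ≠ 0 → (f p).2 ∈ edgeCone i j := by
    rintro p ⟨⟨h0, -, h⟩, h'⟩ hab
    have ha : 0 ≤ p.1 := h0.1
    have hb : 0 ≤ p.2.1 := h0.2.1
    have hxi : 0 ≤ p.2.2.1 i := h0.2.2.1 i
    have hyj : 0 ≤ p.2.2.2 j := h0.2.2.2 j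
    have hx : ∀ k, k ≠ i → p.2.2.1 k = 0 := fun k hk =>
      hab.elim (h k).1.resolve_left ((h' k).1 hk).resolve_left
    have hy : ∀ k, k ≠ j → p.2.2.2 k = 0 := fun k hk =>
      hab.elim ((h' k).2 hk).resolve_left (h k).2.1.resolve_left
    obtain ⟨h1, h2, h3⟩ := hfedge p h0 (hx j hij.symm) (hy i hij) fun k hki hkj =>
      ⟨hx k hki, hy k hkj⟩
    refine ⟨fun h4 => ?_, by linarith, by linarith, h3⟩
    rw [h4, Pi.zero_apply] at h1 h2
    exact hab.elim (fun h => h (by linarith)) fun h => h (by linarith)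
  have hfmaps : Set.MapsTo f (handleCone i j) (edgeWedgeCone i j) := by
    intro p hp
    obtain ⟨⟨h0, hne, h⟩, h'⟩ := id hp
    by_cases hab : p.1 ≠ 0 ∨ p.2.1 ≠ 0
    · refine .inr ⟨fun hu => ?_, hfedge' p hp hab⟩
      have h2 : p.1 = p.2.1 := sub_eq_zero.1 (congrArg Prod.snd hu)
      have ha : p.1 ≠ 0 := hab.elim id fun hb => h2 ▸ hb
      have h1 : ∑ k, (p.2.2.1 k + p.2.2.2 k) - min p.1 p.2.1 = 0 := congrArg Prod.fst hu
      rw [Finset.sum_eq_zero fun k _ => by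
        rw [(h k).1.resolve_left ha, (h k).2.1.resolve_left (h2 ▸ ha), add_zero], ← h2, min_self,
        zero_sub, neg_eq_zero] at h1
      exact ha h1
    · push Not at hab
      obtain ⟨ha, hb⟩ := hab
      have hne' : ∃ k, p.2.2.1 k ≠ 0 ∨ p.2.2.2 k ≠ 0 := by
        by_contra! h1
        exact hne (Prod.ext ha (Prod.ext hb
          (Prod.ext (funext fun k => (h1 k).1) (funext fun k => (h1 k).2))))
      obtain ⟨k, hk⟩ := hne'
      have hxk : 0 ≤ p.2.2.1 k := h0.2.2.1 k
      have hyk : 0 ≤ p.2.2.2 k := h0.2.2.2 k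
      refine .inl ⟨?_, by simp [f, ha, hb], fun h1 => ?_⟩
      · simp only [f, ha, hb, min_self, sub_zero]
        refine Finset.sum_pos' (fun k _ => add_nonneg (h0.2.2.1 k) (h0.2.2.2 k))
          ⟨k, Finset.mem_univ k, ?_⟩
        rcases hk with hk | hk
        · exact add_pos_of_pos_of_nonneg (hxk.lt_of_ne' hk) hyk
        · exact add_pos_of_nonneg_of_pos hxk (hyk.lt_of_ne' hk)
      · have h2 : p.2.2.1 k - p.2.2.2 k = 0 := by simpa [f, ha, hb] using congrFun h1 k
        rcases (h k).2.2 with h3 | h3 <;> rcases hk with hk | hk <;> apply hk <;> linarith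
  have hgmaps : Set.MapsTo g (edgeWedgeCone i j) (handleCone i j) := by
    rintro ⟨⟨a, b⟩, v⟩ hw
    have hne : g ((a, b), v) ≠ 0 := by
      intro h
      have h1 : max (b - a) 0 = 0 := congrArg Prod.fst h
      have h2 : max (-b - a) 0 = 0 := congrArg (fun p => p.2.1) h
      have hx : ∀ k, (g ((a, b), v)).2.2.1 k = 0 := fun k => by rw [h]; rfl
      have hy : ∀ k, (g ((a, b), v)).2.2.2 k = 0 := fun k => by rw [h]; rfl
      rw [max_eq_right_iff] at h1 h2
      have ha : 0 < a := by
        rcases hw with hw | hw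
        · exact hw.1
        · refine lt_of_le_of_ne (by linarith) fun ha => hw.1 ?_
          subst ha
          exact Prod.ext rfl (by change b = 0; linarith)
      rcases lt_trichotomy b 0 with hb | rfl | hb
      · have h3 := ((add_eq_zero_iff_of_nonneg (mul_nonneg (le_max_right _ _) (le_max_right _ _))
          (mul_nonneg (mul_nonneg (le_max_right _ _) (le_max_right _ _)) (hδ i i))).1 (hx i)).2
        simp only [max_eq_left ha.le, hδ1, mul_one, max_eq_left (neg_pos.2 hb).le] at h3
        exact (mul_pos ha (neg_pos.2 hb)).ne' h3
      · have hv : v ≠ 0 := hw.elim (fun hw => hw.2.2) fun hw => hw.2.1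
        refine hv (funext fun k => ?_)
        have h3 := hx k
        have h4 := hy k
        simp [hgray ((a, 0), v) ha rfl, ha.ne'] at h3 h4
        exact le_antisymm h3 h4
      · have h3 := ((add_eq_zero_iff_of_nonneg (mul_nonneg (le_max_right _ _) (le_max_right _ _))
          (mul_nonneg (mul_nonneg (le_max_right _ _) (le_max_right _ _)) (hδ j j))).1 (hy j)).2
        simp only [max_eq_left ha.le, hδ1, mul_one, max_eq_left hb.le] at h3
        exact (mul_pos ha hb).ne' h3
    refine ⟨⟨hg0 _, hne, fun k => ⟨?_, ?_, ?_⟩⟩, fun k => ⟨fun hk => ?_, fun hk => ?_⟩⟩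
    · exact or_iff_not_imp_left.2 fun h => hgx _ h k
    · exact or_iff_not_imp_left.2 fun h => hgy _ h k
    · rcases hw with hw | hw
      · rw [hgray _ hw.1 hw.2.1]
        rcases le_total (v k) 0 with h | h <;> simp [h]
      · obtain ⟨h1, h2, h3⟩ := hgedge (a, b) v hw.2
        by_cases hki : k = i
        · exact .inr (hki ▸ h2)
        by_cases hkj : k = j
        · exact .inl (hkj ▸ h1)
        exact .inl (h3 k hki hkj).1
    · rcases hw with hw | hw
      · rw [hgray _ hw.1 hw.2.1]
        exact .inl rfl
      · obtain ⟨h1, h2, h3⟩ := hgedge (a, b) v hw.2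
        by_cases hkj : k = j
        · exact .inr (hkj ▸ h1)
        exact .inr (h3 k hk hkj).1
    · rcases hw with hw | hw
      · rw [hgray _ hw.1 hw.2.1]
        exact .inl rfl
      · obtain ⟨h1, h2, h3⟩ := hgedge (a, b) v hw.2
        by_cases hki : k = i
        · exact .inr (hki ▸ h2)
        exact .inr (h3 k hki hk).2
  refine nonempty_homotopyEquiv_of_segments f g ?_ ?_ hfmaps hgmaps ?_ ?_
  · simp only [f]; fun_prop
  · simp only [g]; fun_prop
  · intro p hp s t hs ht _
    obtain ⟨⟨h0, hne, h⟩, h'⟩ := id hp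
    have ha : 0 ≤ p.1 := h0.1
    have hb : 0 ≤ p.2.1 := h0.2.1
    have hσ : 0 ≤ ∑ k, (p.2.2.1 k + p.2.2.2 k) :=
      Finset.sum_nonneg fun k _ => add_nonneg (h0.2.2.1 k) (h0.2.2.2 k)
    suffices hk : ∀ k, (p.1 = 0 ∧ (g (f p)).1 = 0 ∨ p.2.2.1 k = 0 ∧ (g (f p)).2.2.1 k = 0) ∧
        (p.2.1 = 0 ∧ (g (f p)).2.1 = 0 ∨ p.2.2.2 k = 0 ∧ (g (f p)).2.2.2 k = 0) ∧
        (p.2.2.1 k = 0 ∧ (g (f p)).2.2.1 k = 0 ∨ p.2.2.2 k = 0 ∧ (g (f p)).2.2.2 k = 0) ∧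
        (k ≠ i → p.2.1 = 0 ∧ (g (f p)).2.1 = 0 ∨ p.2.2.1 k = 0 ∧ (g (f p)).2.2.1 k = 0) ∧
        (k ≠ j → p.1 = 0 ∧ (g (f p)).1 = 0 ∨ p.2.2.2 k = 0 ∧ (g (f p)).2.2.2 k = 0) from
      ⟨⟨add_nonneg (smul_nonneg hs.le h0) (smul_nonneg ht.le (hg0 _)),
        smul_add_smul_ne_zero h0 hne (hg0 _) hs ht, fun k => ⟨comb_eq_zero_or (hk k).1 s t,
          comb_eq_zero_or (hk k).2.1 s t, comb_eq_zero_or (hk k).2.2.1 s t⟩⟩,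
        fun k => ⟨fun hki => comb_eq_zero_or ((hk k).2.2.2.1 hki) s t,
          fun hkj => comb_eq_zero_or ((hk k).2.2.2.2 hkj) s t⟩⟩
    by_cases hab : p.1 ≠ 0 ∨ p.2.1 ≠ 0
    · obtain ⟨hj, hi, hk'⟩ := hgedge (f p).1 (f p).2 (hfedge' p hp hab)
      have hA : p.1 = 0 → (g (f p)).1 = 0 := by
        intro h1
        simp only [f, g, h1, min_eq_left hb]
        exact max_eq_right (by linarith)
      have hB : p.2.1 = 0 → (g (f p)).2.1 = 0 := by
        intro h1
        simp only [f, g, h1, min_eq_right ha]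
        exact max_eq_right (by linarith)
      have hneg : p.1 ≠ 0 → p.2.1 ≠ 0 → (f p).1.1 ≤ 0 := by
        intro h1 h2
        simp only [f]
        rw [Finset.sum_eq_zero fun k _ => by
          rw [(h k).1.resolve_left h1, (h k).2.1.resolve_left h2, add_zero]]
        linarith [le_min ha hb]
      have hX : p.1 ≠ 0 → ∀ k, p.2.2.1 k = 0 ∧ (g (f p)).2.2.1 k = 0 := by
        intro h1 k
        have hx := (h k).1.resolve_left h1
        refine ⟨hx, ?_⟩
        by_cases h2 : p.2.1 = 0
        · have h3 : (f p).2 k ≤ 0 := by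
            have h4 : 0 ≤ p.2.2.2 k := h0.2.2.2 k
            have h5 := mul_nonneg ha (hδ j k)
            simp only [f, hx, h2]
            linarith
          have h4 : -(f p).1.2 ≤ 0 := by simpa [f, h2] using ha
          simp only [g, max_eq_right h3, max_eq_right h4, mul_zero, zero_mul, add_zero]
        · have h3 := hneg h1 h2
          have h4 : (f p).1.1 - max (f p).1.2 0 ≤ 0 := by linarith [le_max_right (f p).1.2 0]
          simp only [g, max_eq_right h3, max_eq_right h4, zero_mul, add_zero]
      have hY : p.2.1 ≠ 0 → ∀ k, p.2.2.2 k = 0 ∧ (g (f p)).2.2.2 k = 0 := by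
        intro h1 k
        have hy := (h k).2.1.resolve_left h1
        refine ⟨hy, ?_⟩
        by_cases h2 : p.1 = 0
        · have h3 : -(f p).2 k ≤ 0 := by
            have h4 : 0 ≤ p.2.2.1 k := h0.2.2.1 k
            have h5 := mul_nonneg hb (hδ i k)
            simp only [f, hy, h2]
            linarith
          have h4 : (f p).1.2 ≤ 0 := by simpa [f, h2] using hb
          simp only [g, max_eq_right h3, max_eq_right h4, mul_zero, zero_mul, add_zero]
        · have h3 := hneg h2 h1
          have h4 : (f p).1.1 - max (-(f p).1.2) 0 ≤ 0 := by linarith [le_max_right (-(f p).1.2) 0]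
          simp only [g, max_eq_right h3, max_eq_right h4, zero_mul, add_zero]
      intro k
      refine ⟨?_, ?_, ?_, fun hki => ?_, fun hkj => ?_⟩
      · by_cases h1 : p.1 = 0
        exacts [.inl ⟨h1, hA h1⟩, .inr (hX h1 k)]
      · by_cases h1 : p.2.1 = 0
        exacts [.inl ⟨h1, hB h1⟩, .inr (hY h1 k)]
      · exact hab.imp (fun h => hX h k) fun h => hY h k
      · by_cases h1 : p.2.1 = 0
        · exact .inl ⟨h1, hB h1⟩
        · refine .inr ⟨((h' k).1 hki).resolve_left h1, ?_⟩
          by_cases hkj : k = j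
          exacts [hkj ▸ hj, (hk' k hki hkj).1]
      · by_cases h1 : p.1 = 0
        · exact .inl ⟨h1, hA h1⟩
        · refine .inr ⟨((h' k).2 hkj).resolve_left h1, ?_⟩
          by_cases hki : k = i
          exacts [hki ▸ hi, (hk' k hki hkj).2]
    · push Not at hab
      obtain ⟨h1, h2⟩ := hab
      have hf : f p = ((∑ k, (p.2.2.1 k + p.2.2.2 k), 0), fun k => p.2.2.1 k - p.2.2.2 k) := by
        simp [f, h1, h2]
      have hpos : 0 < ∑ k, (p.2.2.1 k + p.2.2.2 k) := by
        refine hσ.lt_of_ne' fun h3 => hne ?_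
        have hxy : ∀ k, p.2.2.1 k = 0 ∧ p.2.2.2 k = 0 := fun k =>
          (add_eq_zero_iff_of_nonneg (h0.2.2.1 k) (h0.2.2.2 k)).1
            ((Finset.sum_eq_zero_iff_of_nonneg
              fun k _ => add_nonneg (h0.2.2.1 k) (h0.2.2.2 k)).1 h3 k (Finset.mem_univ k))
        exact Prod.ext h1 (Prod.ext h2
          (Prod.ext (funext fun k => (hxy k).1) (funext fun k => (hxy k).2)))
      rw [hf, hgray _ hpos rfl]
      refine fun k => ⟨.inl ⟨h1, rfl⟩, .inl ⟨h2, rfl⟩, ?_, fun _ => .inl ⟨h2, rfl⟩,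
        fun _ => .inl ⟨h1, rfl⟩⟩
      have hxk : 0 ≤ p.2.2.1 k := h0.2.2.1 k
      have hyk : 0 ≤ p.2.2.2 k := h0.2.2.2 k
      exact (h k).2.2.imp (fun h => ⟨h, by simp [h, hyk]⟩) fun h => ⟨h, by simp [h, hxk]⟩
  · rintro w hw s t hs ht _
    have hgw := hg0 w
    rcases id hw with ⟨hu, hu', hv⟩ | ⟨hu, hv⟩
    · have hσ : 0 ≤ ∑ k, ((g w).2.2.1 k + (g w).2.2.2 k) :=
        Finset.sum_nonneg fun k _ => add_nonneg (hgw.2.2.1 k) (hgw.2.2.2 k)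
      have h1 : (f (g w)).1.1 = ∑ k, ((g w).2.2.1 k + (g w).2.2.2 k) := by
        simp [f, hgray w hu hu']
      have h2 : (f (g w)).1.2 = 0 := by simp [f, hgray w hu hu']
      have h3 : (f (g w)).2 = w.1.1 • w.2 := by
        ext k
        simp only [f, hgray w hu hu', zero_mul, add_zero, sub_zero, Pi.smul_apply, smul_eq_mul]
        rcases le_total (w.2 k) 0 with h | h <;> simp [h]
      refine .inl ⟨?_, ?_, ?_⟩
      · simp only [Prod.fst_add, Prod.smul_fst, h1, smul_eq_mul]
        positivity
      · simp [hu', h2]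
      · simp only [Prod.snd_add, Prod.smul_snd, h3, smul_smul, ← add_smul]
        exact smul_ne_zero (by positivity) hv
    · obtain ⟨hj, hi, hk⟩ := hgedge w.1 w.2 hv
      obtain ⟨h1, h2, h3⟩ := hfedge (g w) hgw hj hi hk
      have ha : 0 ≤ (g w).1 := hgw.1
      have hb : 0 ≤ (g w).2.1 := hgw.2.1
      have hxi : 0 ≤ (g w).2.2.1 i := hgw.2.2.1 i
      have hyj : 0 ≤ (g w).2.2.2 j := hgw.2.2.2 j
      refine .inr ⟨fun h => ?_,
        smul_add_smul_mem_edgeCone hv (by linarith) (by linarith) h3 hs ht.le⟩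
      have h4 : s * w.1.1 + t * (f (g w)).1.1 = 0 := congrArg Prod.fst h
      have h5 : s * w.1.2 + t * (max (w.1.2 - w.1.1) 0 - max (-w.1.2 - w.1.1) 0) = 0 :=
        congrArg Prod.snd h
      -- The round trip never reverses the sign of the second planar coordinate, nor that of the
      -- first when the second is zero, so the segment avoids the origin of the plane.
      rcases lt_trichotomy w.1.2 0 with h6 | h6 | h6
      · have h7 : max (w.1.2 - w.1.1) 0 ≤ max (-w.1.2 - w.1.1) 0 :=
          max_le_max_right _ (by linarith)
        have := mul_neg_of_pos_of_neg hs h6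
        have := mul_nonpos_of_nonneg_of_nonpos ht.le (sub_nonpos.2 h7)
        linarith
      · rcases lt_trichotomy w.1.1 0 with h7 | h7 | h7
        · have h8 : (f (g w)).1.1 ≤ 0 := by
            simp [f, g, h6, h7.le]
          have := mul_neg_of_pos_of_neg hs h7
          have := mul_nonpos_of_nonneg_of_nonpos ht.le h8
          linarith
        · exact hu (Prod.ext h7 h6)
        · have h8 : 0 ≤ (f (g w)).1.1 := by
            simp only [f, hgray w h7 h6, min_self, sub_zero]
            exact Finset.sum_nonneg fun k _ => by positivity
          have := mul_pos hs h7
          have := mul_nonneg ht.le h8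
          linarith
      · have h7 : max (-w.1.2 - w.1.1) 0 ≤ max (w.1.2 - w.1.1) 0 :=
          max_le_max_right _ (by linarith)
        have := mul_pos hs h6
        have := mul_nonneg ht.le (sub_nonneg.2 h7)
        linarith

theorem nonempty_homotopyEquiv_deltaSpace_three (m : ℕ) (hm : 2 ≤ m) :
    Nonempty (DeltaSpace m 3 ≃ₕ Wedge (Sphere.base 1) (Sphere.base (m - 1))) := by
  -- Two distinct indices are needed, since x i and y j span an edge of the cross-polytope only for
  -- i ≠ j; this is where m ≥ 2 enters.
  let i : Fin m := ⟨0, by omega⟩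
  let j : Fin m := ⟨1, by omega⟩
  have hij : i ≠ j := by simp [i, j]
  obtain ⟨e₁⟩ := nonempty_homotopyEquiv_independenceCone (deltaGraph m 3)
  obtain ⟨e₂⟩ := nonempty_homotopyEquiv_shortPathsCone m
  obtain ⟨e₃⟩ := nonempty_shortPathsCone_homotopyEquiv_handleCone i j
  obtain ⟨e₄⟩ := nonempty_handleCone_homotopyEquiv_edgeWedgeCone hij
  obtain ⟨e₅⟩ := nonempty_homotopyEquiv_wedgeCone hij
  obtain ⟨e₆⟩ := nonempty_wedgeCone_homotopyEquiv_wedge (d := 1) (d' := m - 1)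
    (p := ((1, 0) : ℝ × ℝ)) (q := (Pi.single i 1 - Pi.single j 1 : Fin m → ℝ)) (by simp)
    (by simp; omega) (by simp) (fun h => by simpa [hij] using congrFun h i)
  exact ⟨((((e₁.trans e₂).trans e₃).trans e₄).trans e₅).trans e₆⟩

theorem proposition1p2 (m : ℕ) (hm : 2 ≤ m) :
    Nonempty (DeltaSpace m 1 ≃ₜ PUnit.{1}) ∧
    Nonempty (DeltaSpace m 2 ≃ₕ Sphere 0) ∧
    Nonempty (DeltaSpace m 3 ≃ₕ Wedge (Sphere.base 1) (Sphere.base (m - 1))) ∧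
    Nonempty (DeltaSpace m 4 ≃ₕ Sphere m) :=
  ⟨nonempty_homeomorph_deltaSpace_one m, nonempty_homotopyEquiv_deltaSpace_two m (by omega),
    nonempty_homotopyEquiv_deltaSpace_three m hm,
    nonempty_homotopyEquiv_deltaSpace_four m (by omega)⟩
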